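/- Let $\mathcal P\subset\mathbb R^2\setminus\{0\}$ be a finite set such that no two distinct points $y,z\in\mathcal P$ lie on a common half-line issued from $0$ (i.e. $\widehat{y0z}\neq 0$) and no two distinct points of $\mathcal P$ have the same Euclidean norm. Order $\mathcal P$ by $y<z\iff\|y\|<\|z\|$. Fix $x\in\mathcal P$, put $\mathcal P_x=\{y\in\mathcal P: y\le x\}$, and let $\gamma:[0,1]\to\mathbb R^2\setminus\mathcal P$ be a continuous path with $\gamma(0)=0$ such that the segment $[\gamma(1),0]$ does not meet $\mathcal P_x$. For $y\in\mathcal P_x$ let $\ell_y$ be the loop that goes straight from $0$ to a small neighbourhood of $y$, turns once counterclockwise around $y$, and goes straight back to $0$. Let $g_x^1$ be the word of the free group $\mathbb F_{\mathcal P_x}$ representing, in the basis $([\ell_y])_{y\in\mathcal P_x}$, the class in $\pi_1(\mathbb R^2\setminus\mathcal P_x,0)$ of the loop $\gamma\cdot[\gamma(1),0]$ (the path $\gamma$ followed by the straight segment from $\gamma(1)$ back to $0$); this word exists and is unique. Write $g_x^1=a_1^{\alpha_1}\cdots a_\ell^{\alpha_\ell}$ with $a_i\in\mathcal P_x$, $\alpha_i\in\mathbb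 Z\setminus\{0\}$ and $a_i\neq a_{i+1}$, and let $\alpha_x(g_x^1)$ be the sequence of those $\alpha_i$ for which $a_i=x$, in increasing order of $i$, completed by zeros. Let $d_x^1,d_x^2$ be the two half-lines issued from $x$ and orthogonal to the vector from $0$ to $x$, in either of the two possible orders. Let $t_0=0$ and, for $i\ge 0$, let $t_{i+1}=\inf\{t\in[0,1]: t>t_i,\ \gamma(t)\in d\}$, where $d=d_x^1$ if $i+1$ is odd, $d=d_x^2$ if $i+1$ is even, and $\inf\emptyset=+\infty$. Let $\theta_{1/2}(x,\gamma)$, the number of half-turns of $\gamma$ around $x$, be one plus the largest index $i$ such that $t_i<\infty$. Then $$\|\alpha_x(g_x^1)\|_{\ell^1}\le\theta_{1/2}(x,\gamma).$$ -/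

import Mathlib

/-! Throughout, the Euclidean plane is `ℂ`. -/

open scoped unitInterval

noncomputable section

namespace HalfTurns

/-- A finite set of punctures, none at the origin, no two of them on a common half-line from the
origin, and no two of them of equal norm. -/
structure IsGeneric (P : Set ℂ) : Prop where
  finite : P.Finite
  zero_notMem : (0 : ℂ) ∉ P
  angle_ne_zero : ∀ y ∈ P, ∀ z ∈ P, y ≠ z → EuclideanGeometry.angle y 0 z ≠ 0
  norm_ne : ∀ y ∈ P, ∀ z ∈ P, y ≠ z → ‖y‖ ≠ ‖z‖

/-- The points of `P` that are at most `x`, for the order by distance to the origin. -/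
def lowerPoints (P : Set ℂ) (x : ℂ) : Set ℂ := {y | y ∈ P ∧ ‖y‖ ≤ ‖x‖}

theorem IsGeneric.lowerPoints {P : Set ℂ} (hP : IsGeneric P) (x : ℂ) :
    IsGeneric (lowerPoints P x) where
  finite := hP.finite.subset fun _ h => h.1
  zero_notMem h := hP.zero_notMem h.1
  angle_ne_zero y hy z hz := hP.angle_ne_zero y hy.1 z hz.1
  norm_ne y hy z hz := hP.norm_ne y hy.1 z hz.1

/-! ### The fundamental group of the punctured plane and its basis of straight lassos -/

/-- A path in `X` with values in `S`, as a path in `S`. -/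
def restrictPath {X : Type*} [TopologicalSpace X] {S : Set X} {a b : X} (p : Path a b)
    (h : ∀ t, p t ∈ S) :
    Path (⟨a, p.source ▸ h 0⟩ : S) (⟨b, p.target ▸ h 1⟩ : S) where
  toFun t := ⟨p t, h t⟩
  continuous_toFun := p.continuous.subtype_mk h
  source' := Subtype.ext p.source
  target' := Subtype.ext p.target

/-- The group `π₁(ℂ ∖ Q, 0)` in which the product of two classes is the class of the concatenation
in the same order (Mathlib's `FundamentalGroup` has the opposite product). -/
abbrev Pi1 (Q : Set ℂ) (h0 : (0 : ℂ) ∈ Qᶜ) : Type :=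
  (FundamentalGroup (Qᶜ : Set ℂ) ⟨0, h0⟩)ᵐᵒᵖ

/-- The class in `π₁(ℂ ∖ Q, 0)` of a loop of the plane based at `0` that avoids `Q`. -/
def loopClass {Q : Set ℂ} (p : Path (0 : ℂ) 0) (h : ∀ t, p t ∈ Qᶜ) :
    Pi1 Q (p.source ▸ h 0) :=
  MulOpposite.op (FundamentalGroup.fromPath (Path.Homotopic.Quotient.mk (restrictPath p h)))

/-- Half of the distance from `y` to the origin and to the other points of `Q`, divided by `‖y‖`. -/
def lassoRatio (Q : Set ℂ) (y : ℂ) : ℝ :=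
  Metric.infDist y (insert 0 (Q \ {y})) / 2 / ‖y‖

/-- The circle of centre `y` and radius `ρ ‖y‖`, run once counterclockwise from `(1 - ρ) y`. -/
def circlePath (y : ℂ) (ρ : ℝ) : Path ((1 - ρ : ℂ) * y) ((1 - ρ : ℂ) * y) where
  toFun t := (1 - ρ * Complex.exp (2 * Real.pi * (t : ℝ) * Complex.I)) * y
  continuous_toFun := by fun_prop
  source' := by simp
  target' := by simp

/-- The loop that goes straight from `0` towards `y`, turns once counterclockwise around `y` on a
small circle, and goes straight back to `0`. -/
def lasso (y : ℂ) (ρ : ℝ) : Path (0 : ℂ) 0 :=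
  (Path.segment 0 ((1 - ρ : ℂ) * y)).trans
    ((circlePath y ρ).trans (Path.segment 0 ((1 - ρ : ℂ) * y)).symm)

theorem lassoRatio_pos {Q : Set ℂ} (hQ : IsGeneric Q) {y : ℂ} (hy : y ∈ Q) :
    0 < lassoRatio Q y := by
  have hy0 : y ≠ 0 := fun h => hQ.zero_notMem (h ▸ hy)
  have hcl : IsClosed (insert 0 (Q \ {y}) : Set ℂ) :=
    ((hQ.finite.subset Set.sdiff_subset).insert 0).isClosed
  have : 0 < Metric.infDist y (insert 0 (Q \ {y})) :=
    (hcl.notMem_iff_infDist_pos (Set.insert_nonempty _ _)).1 (by simp [hy0])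
  have := norm_pos_iff.2 hy0
  unfold lassoRatio
  positivity

theorem lassoRatio_mul_norm {Q : Set ℂ} (hQ : IsGeneric Q) {y : ℂ} (hy : y ∈ Q) :
    lassoRatio Q y * ‖y‖ = Metric.infDist y (insert 0 (Q \ {y})) / 2 := by
  have hy0 : y ≠ 0 := fun h => hQ.zero_notMem (h ▸ hy)
  unfold lassoRatio
  field_simp [norm_ne_zero_iff.2 hy0]

theorem lassoRatio_lt_one {Q : Set ℂ} (hQ : IsGeneric Q) {y : ℂ} (hy : y ∈ Q) :
    lassoRatio Q y < 1 := by
  have hy0 : 0 < ‖y‖ := norm_pos_iff.2 fun h => hQ.zero_notMem (h ▸ hy)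
  have h1 : Metric.infDist y (insert 0 (Q \ {y})) ≤ dist y 0 :=
    Metric.infDist_le_dist_of_mem (Set.mem_insert _ _)
  rw [dist_zero_right] at h1
  have h2 := lassoRatio_mul_norm hQ hy
  by_contra! h
  nlinarith

theorem segment_notMem {Q : Set ℂ} (hQ : IsGeneric Q) {y : ℂ} (hy : y ∈ Q) (t : I) :
    Path.segment 0 ((1 - lassoRatio Q y : ℂ) * y) t ∈ Qᶜ := by
  intro hw
  set w := Path.segment 0 ((1 - lassoRatio Q y : ℂ) * y) t with hwdef
  have hy0 : y ≠ 0 := fun h => hQ.zero_notMem (h ▸ hy)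
  set s : ℝ := t * (1 - lassoRatio Q y) with hs
  have hws : w = s • y := by
    rw [hwdef, hs]
    simp [AffineMap.lineMap_apply]
    ring
  have hs1 : s < 1 := by
    have := lassoRatio_pos hQ hy
    have := lassoRatio_lt_one hQ hy
    have := t.2.1
    have := t.2.2
    rw [hs]
    nlinarith
  have hs0 : 0 < s := by
    refine lt_of_le_of_ne ?_ ?_
    · have := lassoRatio_lt_one hQ hy
      exact mul_nonneg t.2.1 (by linarith)
    · intro h
      rw [← h, zero_smul] at hws
      exact hQ.zero_notMem (hws ▸ hw)
  have hne : y ≠ w := by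
    intro h
    rw [hws] at h
    have : (1 - s) • y = 0 := by rw [sub_smul, one_smul, ← h, sub_self]
    rcases smul_eq_zero.1 this with h' | h'
    · linarith
    · exact hy0 h'
  refine hQ.angle_ne_zero y hy w hw hne ?_
  rw [EuclideanGeometry.angle, vsub_eq_sub, vsub_eq_sub, sub_zero, sub_zero, hws,
    InnerProductGeometry.angle_smul_right_of_pos _ _ hs0, InnerProductGeometry.angle_self hy0]

theorem circlePath_notMem {Q : Set ℂ} (hQ : IsGeneric Q) {y : ℂ} (hy : y ∈ Q) (t : I) :
    circlePath y (lassoRatio Q y) t ∈ Qᶜ := by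
  intro hw
  have hpos := lassoRatio_pos hQ hy
  have hy0 : 0 < ‖y‖ := norm_pos_iff.2 fun h => hQ.zero_notMem (h ▸ hy)
  have hmul := lassoRatio_mul_norm hQ hy
  have hd : dist y (circlePath y (lassoRatio Q y) t) = lassoRatio Q y * ‖y‖ := by
    have h1 : y - circlePath y (lassoRatio Q y) t
        = lassoRatio Q y * Complex.exp ((2 * Real.pi * (t : ℝ) : ℝ) * Complex.I) * y := by
      simp [circlePath]
      ring
    rw [dist_eq_norm, h1, norm_mul, norm_mul, Complex.norm_exp_ofReal_mul_I, mul_one,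
      Complex.norm_real, Real.norm_of_nonneg hpos.le]
  have hne : circlePath y (lassoRatio Q y) t ≠ y := by
    intro h
    rw [h, dist_self] at hd
    have := mul_pos hpos hy0
    linarith
  have h2 : Metric.infDist y (insert 0 (Q \ {y})) ≤ dist y (circlePath y (lassoRatio Q y) t) :=
    Metric.infDist_le_dist_of_mem (Set.mem_insert_of_mem _ ⟨hw, hne⟩)
  have := mul_pos hpos hy0
  linarith

theorem trans_mem {X : Type*} [TopologicalSpace X] {S : Set X} {a b c : X} {p : Path a b}
    {q : Path b c} (hp : ∀ t, p t ∈ S) (hq : ∀ t, q t ∈ S) (t : I) : p.trans q t ∈ S := by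
  rw [Path.trans_apply]
  split_ifs
  · exact hp _
  · exact hq _

theorem lasso_notMem {Q : Set ℂ} (hQ : IsGeneric Q) {y : ℂ} (hy : y ∈ Q) (t : I) :
    lasso y (lassoRatio Q y) t ∈ Qᶜ :=
  trans_mem (segment_notMem hQ hy)
    (trans_mem (circlePath_notMem hQ hy) fun _ => segment_notMem hQ hy _) t

/-- The homomorphism from the free group on `Q` to `π₁(ℂ ∖ Q, 0)` that sends each letter `y` to the
class of the lasso along the straight segment from `0` to `y`. -/
def straightHom {Q : Set ℂ} (hQ : IsGeneric Q) : FreeGroup Q →* Pi1 Q hQ.zero_notMem :=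
  FreeGroup.lift fun y => loopClass (lasso y (lassoRatio Q y)) (lasso_notMem hQ y.2)

/-- The path `γ` from `0` to `z`, followed by the straight segment from `z` back to `0`. -/
def closeUp {z : ℂ} (γ : Path (0 : ℂ) z) : Path (0 : ℂ) 0 := γ.trans (Path.segment z 0)

theorem closeUp_notMem {Q : Set ℂ} {z : ℂ} {γ : Path (0 : ℂ) z} (hγ : ∀ t, γ t ∉ Q)
    (hz : ∀ y ∈ Q, y ∉ segment ℝ 0 z) (t : I) : closeUp γ t ∈ Qᶜ := by
  refine trans_mem (S := Qᶜ) hγ (fun s hs => hz _ hs ?_) t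
  rw [segment_symm, segment_eq_image_lineMap]
  exact ⟨s, s.2, by simp⟩

/-! ### Exponent sequences -/

section Exponents

variable {A : Type*}

open Classical in
/-- The syllables `(aᵢ, αᵢ)` of an element `a₁ ^ α₁ ⋯ aₗ ^ αₗ` of a free group, with `αᵢ ≠ 0` and
`aᵢ ≠ aᵢ₊₁`: the maximal runs of a common letter in the reduced word. -/
def syllables (g : FreeGroup A) : List (A × ℤ) :=
  (g.toWord.splitBy fun a b => decide (a.1 = b.1)).filterMap fun run =>
    run.head?.map fun a => (a.1, (run.map fun c => if c.2 then (1 : ℤ) else -1).sum)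

open Classical in
/-- The ultimately vanishing sequence of the exponents to which the letter `x` appears in `g`. -/
def exponentSeq (x : A) (g : FreeGroup A) : ℕ →₀ ℤ :=
  (((syllables g).filter fun s => decide (s.1 = x)).map Prod.snd).toFinsupp

end Exponents

/-- The `ℓ¹`-norm of an ultimately vanishing sequence of integers. -/
def l1Norm (u : ℕ →₀ ℤ) : ℕ := u.sum fun _ a => a.natAbs

/-! ### Half-turns -/

/-- The half-line from `x` in the direction `v`. -/
def halfLine (x v : ℂ) : Set ℂ := {w | ∃ s : ℝ, 0 ≤ s ∧ w = x + s • v}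

/-- The times `t₀ = 0` and `tₙ₊₁ = inf {t > tₙ : γ t ∈ d}`, where `d` is `d₁` for `n + 1` odd and
`d₂` for `n + 1` even, with value `⊤` if there is no such `t` in `[0, 1]`. -/
def halfTurnTime (γ : I → ℂ) (d₁ d₂ : Set ℂ) : ℕ → EReal
  | 0 => 0
  | n + 1 => sInf {u | ∃ t : I, u = ((t : ℝ) : EReal) ∧ halfTurnTime γ d₁ d₂ n < ((t : ℝ) : EReal) ∧
      γ t ∈ if Odd (n + 1) then d₁ else d₂}

/-- The number of half-turns: one plus the largest index of a finite half-turn time. -/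
def halfTurns (γ : I → ℂ) (d₁ d₂ : Set ℂ) : ℕ :=
  sSup {n : ℕ | halfTurnTime γ d₁ d₂ n ≠ ⊤} + 1

end HalfTurns

end

/-! Let $Q$ be the set of punctures at most $x$, and cut the plane along the rays that prolong the
segments from $0$ to the points of $Q$. What remains is star-shaped about $0$, so the homotopy class
of a path is recorded by its signed crossings of the rays. The lasso around $y$ is the loop that
crosses only the ray of $y$, once, from right to left. Joining end points to the origin by base
paths (`baseClass`) attaches words to all path classes, not only to loops, and concatenation
multiplies words (`Represents`). A path that misses the ray of $x$ needs no letter $x$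
(`exists_represents`). Uniqueness of the word is `wordClass_injective`: the rays are used to glue
copies of the cut plane, indexed by the free group, into a covering on which loops act by right
multiplication.

The $\ell^1$-norm of the exponents of $x$ is at most the number of letters $x^{\pm1}$ in the reduced
word, and this number is subadditive. It therefore suffices to cut $\gamma$ at the half-turn times
and to represent each piece by a word with at most one $x^{\pm1}$ (`CostLE`).

This is where the order by norm enters. As $x$ is the farthest point of $Q$, the closed half-plane
beyond the line through $x$ orthogonal to $x$ contains no other puncture, and it is still
star-shaped once $x$ is removed (`beyond`). A piece starts on the near side of that line and avoids
one half of it until its end. All its excursions beyond the line can be folded onto the other half,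
which removes every crossing of the ray of $x$. The price is the track of the end point, which stays
beyond the line when it moves and so costs at most one letter (`costLE_one_of_avoid`). If $t_n$ is
the last finite time, the path up to $t_n$ costs at most $n$, the rest of $\gamma$ at most one, and
the closing segment nothing. -/

open scoped unitInterval

noncomputable section

namespace HalfTurns

/-! ### Homotopies of paths -/

section Homotopies

variable {X : Type*} [TopologicalSpace X]

/-- Two paths with values in a star-shaped set that avoids `Q` are homotopic in `Qᶜ`. -/
theorem homotopic_of_starConvex {Q S : Set ℂ} {c : ℂ} (hS : StarConvex ℝ c S) (hSQ : S ⊆ Qᶜ)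
    {a b : (Qᶜ : Set ℂ)} {p q : Path a b} (hp : ∀ t, (p t : ℂ) ∈ S) (hq : ∀ t, (q t : ℂ) ∈ S) :
    Path.Homotopic.Quotient.mk p = Path.Homotopic.Quotient.mk q := by
  have : ContractibleSpace S := hS.contractibleSpace ⟨_, hp 0⟩
  have ha : (a : ℂ) ∈ S := by simpa using hp 0
  have hb : (b : ℂ) ∈ S := by simpa using hp 1
  let lift (r : Path a b) (hr : ∀ t, (r t : ℂ) ∈ S) : Path (⟨a, ha⟩ : S) ⟨b, hb⟩ :=
    { toFun := fun t => ⟨r t, hr t⟩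
      continuous_toFun := (continuous_subtype_val.comp r.continuous).subtype_mk _
      source' := Subtype.ext (by simp)
      target' := Subtype.ext (by simp) }
  exact Path.Homotopic.Quotient.eq.2
    ((SimplyConnectedSpace.paths_homotopic (lift p hp) (lift q hq)).map
      ⟨Set.inclusion hSQ, continuous_inclusion hSQ⟩)

/-- A map of the square that is constant on its left side yields a homotopy between its top side
and its bottom side followed by its right side. -/
theorem homotopic_of_square (F : C(I × I, X)) {a b c : X} {p : Path a b} {q : Path a c}
    {r : Path b c} (hp : ∀ t, F (0, t) = p t) (hq : ∀ t, F (1, t) = q t)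
    (ha : ∀ s, F (s, 0) = a) (hr : ∀ s, F (s, 1) = r s) : (p.trans r).Homotopic q := by
  -- The square is contractible, so the two routes along its boundary from $(0,0)$ to $(1,1)$ are
  -- homotopic; `F` carries this homotopy to `X`.
  let P₀ : Path ((0, 0) : I × I) (0, 1) := ⟨⟨fun t => (0, t), by fun_prop⟩, rfl, rfl⟩
  let P₁ : Path ((1, 0) : I × I) (1, 1) := ⟨⟨fun t => (1, t), by fun_prop⟩, rfl, rfl⟩
  let R : Path ((0, 1) : I × I) (1, 1) := ⟨⟨fun t => (t, 1), by fun_prop⟩, rfl, rfl⟩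
  let L : Path ((0, 0) : I × I) (1, 0) := ⟨⟨fun t => (t, 0), by fun_prop⟩, rfl, rfl⟩
  have hI : ContractibleSpace I :=
    (convex_Icc (0 : ℝ) 1).contractibleSpace ⟨0, by simp⟩
  have h := (SimplyConnectedSpace.paths_homotopic (P₀.trans R) (L.trans P₁)).map F
  have h0 : a = F (0, 0) := (ha 0).symm
  have h1 : c = F (1, 1) := by rw [hq]; simp
  have e₁ : p.trans r = ((P₀.trans R).map F.continuous).cast h0 h1 := by
    ext t
    simp only [Path.trans_apply, Path.cast_coe, Path.map_coe, Function.comp_apply]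
    split_ifs
    · exact (hp _).symm
    · exact (hr _).symm
  have e₂ : (Path.refl a).trans q = ((L.trans P₁).map F.continuous).cast h0 h1 := by
    ext t
    simp only [Path.trans_apply, Path.cast_coe, Path.map_coe, Function.comp_apply]
    split_ifs
    · exact (ha _).symm
    · exact (hq _).symm
  have h2 : (p.trans r).Homotopic ((Path.refl a).trans q) := by
    rw [e₁, e₂]
    exact h.pathCast h0 h1
  exact h2.trans ⟨Path.Homotopy.reflTrans q⟩

theorem subpath_mem {a b : X} (p : Path a b) {S : Set X} {s t : I} (hst : s ≤ t)
    (h : ∀ u, s ≤ u → u ≤ t → p u ∈ S) (u : I) : p.subpath s t u ∈ S := by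
  have : p.subpath s t u ∈ Set.range (p.subpath s t) := ⟨u, rfl⟩
  rw [Path.range_subpath_of_le _ _ _ hst] at this
  obtain ⟨v, hv, hvu⟩ := this
  exact hvu ▸ h v hv.1 hv.2

theorem mk_subpath_trans {a b : X} (p : Path a b) (r s t : I) :
    (Path.Homotopic.Quotient.mk (p.subpath r s)).trans
      (Path.Homotopic.Quotient.mk (p.subpath s t)) =
      Path.Homotopic.Quotient.mk (p.subpath r t) :=
  Path.Homotopic.Quotient.eq.2 ⟨Path.Homotopy.subpathTransSubpath p r s t⟩

end Homotopies

/-- The straight path between two points of `Qᶜ`. -/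
def segPath {Q : Set ℂ} (a b : (Qᶜ : Set ℂ)) (h : segment ℝ (a : ℂ) b ⊆ Qᶜ) : Path a b :=
  restrictPath (Path.segment (a : ℂ) b) fun t => h (Path.range_segment (a : ℂ) b ▸ ⟨t, rfl⟩)

theorem segPath_mem {Q S : Set ℂ} {a b : (Qᶜ : Set ℂ)} (h : segment ℝ (a : ℂ) b ⊆ Qᶜ)
    (hS : segment ℝ (a : ℂ) b ⊆ S) (t : I) : (segPath a b h t : ℂ) ∈ S :=
  hS (Path.range_segment (a : ℂ) b ▸ ⟨t, rfl⟩)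

/-! ### Rays, wedges and the star-shaped domain -/

theorem div_re_comb (a b : ℝ) (p q y : ℂ) :
    ((a • p + b • q) / y).re = a * (p / y).re + b * (q / y).re := by
  rw [add_div, smul_div_assoc, smul_div_assoc]; simp

theorem div_im_comb (a b : ℝ) (p q y : ℂ) :
    ((a • p + b • q) / y).im = a * (p / y).im + b * (q / y).im := by
  rw [add_div, smul_div_assoc, smul_div_assoc]; simp

theorem continuous_div_re (y : ℂ) : Continuous fun w : ℂ => (w / y).re := by fun_prop

theorem continuous_div_im (y : ℂ) : Continuous fun w : ℂ => (w / y).im := by fun_prop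

/-- The part of the half-line from `0` through `y` that starts at `y`. -/
def ray (y : ℂ) : Set ℂ := {w | 1 ≤ (w / y).re ∧ (w / y).im = 0}

theorem isClosed_ray (y : ℂ) : IsClosed (ray y) :=
  (isClosed_le continuous_const (continuous_div_re y)).inter
    (isClosed_eq (continuous_div_im y) continuous_const)

theorem self_mem_ray {y : ℂ} (hy : y ≠ 0) : y ∈ ray y := by simp [ray, hy]

/-- The plane cut along the rays that start at the points of `Q`. -/
def starDomain (Q : Set ℂ) : Set ℂ := {w | ∀ y ∈ Q, w ∉ ray y}

theorem starConvex_compl_ray (y : ℂ) : StarConvex ℝ 0 (ray y)ᶜ := by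
  intro w hw a b ha hb hab ⟨h1, h2⟩
  rw [div_re_comb] at h1
  rw [div_im_comb] at h2
  simp only [zero_div, Complex.zero_re, Complex.zero_im, mul_zero, zero_add] at h1 h2
  have hb0 : 0 < b := by
    rcases hb.lt_or_eq with h | rfl
    · exact h
    · linarith
  refine hw ⟨?_, (mul_eq_zero.1 h2).resolve_left hb0.ne'⟩
  by_contra! h
  nlinarith

theorem starConvex_starDomain (Q : Set ℂ) : StarConvex ℝ 0 (starDomain Q) :=
  fun _ hw _ _ ha hb hab y hy => starConvex_compl_ray y (hw y hy) ha hb hab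

theorem zero_mem_starDomain (Q : Set ℂ) : (0 : ℂ) ∈ starDomain Q := by
  rintro y - ⟨h, -⟩
  simp at h
  linarith

theorem IsGeneric.ne_zero {Q : Set ℂ} (hQ : IsGeneric Q) {y : ℂ} (hy : y ∈ Q) : y ≠ 0 :=
  fun h => hQ.zero_notMem (h ▸ hy)

theorem starDomain_subset {Q : Set ℂ} (hQ : IsGeneric Q) : starDomain Q ⊆ Qᶜ :=
  fun w hw hwQ => hw w hwQ (self_mem_ray (hQ.ne_zero hwQ))

theorem isOpen_starDomain {Q : Set ℂ} (hQ : IsGeneric Q) : IsOpen (starDomain Q) := by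
  have : starDomain Q = (⋃ y ∈ Q, ray y)ᶜ := by ext w; simp [starDomain]
  rw [this]
  exact (hQ.finite.isClosed_biUnion fun y _ => isClosed_ray y).isOpen_compl

/-- The open sector of slope `ε` around the half-line from `0` through `y`. -/
def sector (y : ℂ) (ε : ℝ) : Set ℂ := {w | |(w / y).im| < ε * (w / y).re}

theorem IsGeneric.im_div_ne_zero {Q : Set ℂ} (hQ : IsGeneric Q) {y z : ℂ} (hy : y ∈ Q)
    (hz : z ∈ Q) (hne : z ≠ y) (hre : 0 < (z / y).re) : (z / y).im ≠ 0 := by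
  intro him
  have hy0 := hQ.ne_zero hy
  have h : z = (z / y).re • y := by
    have : z / y = ((z / y).re : ℂ) := Complex.ext (by simp) (by simpa using him)
    rw [Complex.real_smul, ← this, div_mul_cancel₀ _ hy0]
  refine hQ.angle_ne_zero y hy z hz hne.symm ?_
  rw [EuclideanGeometry.angle, vsub_eq_sub, vsub_eq_sub, sub_zero, sub_zero, h,
    InnerProductGeometry.angle_smul_right_of_pos _ _ hre, InnerProductGeometry.angle_self hy0]

/-- No other puncture lies on the half-line through `y`, so each of the finitely many other rays is
excluded by every small enough slope. -/
theorem exists_sector {Q : Set ℂ} (hQ : IsGeneric Q) {y : ℂ} (hy : y ∈ Q) :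
    ∃ ε > 0, ∀ z ∈ Q, z ≠ y → Disjoint (sector y ε) (ray z) := by
  have key : ∀ z ∈ Q, ∀ᶠ ε in nhdsWithin (0 : ℝ) (Set.Ioi 0),
      z ≠ y → Disjoint (sector y ε) (ray z) := by
    intro z hz
    by_cases hne : z = y
    · simp [hne]
    -- A puncture `z` with `(z / y).re ≤ 0` is outside every sector; otherwise its own slope over
    -- `y`, nonzero by genericity, bounds `ε`.
    have hδ : ∃ δ > 0, ∀ ε, 0 < ε → ε < δ → ε * (z / y).re ≤ |(z / y).im| := by
      rcases le_or_gt (z / y).re 0 with h | h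
      · exact ⟨1, one_pos, fun ε h0 _ => le_trans (by nlinarith) (abs_nonneg _)⟩
      · have := abs_pos.2 (hQ.im_div_ne_zero hy hz hne h)
        refine ⟨|(z / y).im| / (z / y).re, by positivity, fun ε _ h1 => ?_⟩
        rw [lt_div_iff₀ h] at h1
        exact h1.le
    obtain ⟨δ, hδ0, hδ⟩ := hδ
    filter_upwards [Ioo_mem_nhdsGT hδ0] with ε hε _
    rw [Set.disjoint_left]
    rintro w hw ⟨h1, h2⟩
    have hz0 := hQ.ne_zero hz
    have hw' : w / y = ((w / z).re : ℂ) * (z / y) := by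
      have : w / z = ((w / z).re : ℂ) := Complex.ext (by simp) (by simpa using h2)
      rw [← this]
      field_simp
    have h3 := hδ ε hε.1 hε.2
    simp only [sector, Set.mem_ofPred_eq, hw', Complex.re_ofReal_mul, Complex.im_ofReal_mul,
      abs_mul, abs_of_nonneg (zero_le_one.trans h1)] at hw
    nlinarith
  obtain ⟨ε, h, hε⟩ := (((Filter.eventually_all_finite hQ.finite).2 key).and
    self_mem_nhdsWithin).exists
  exact ⟨ε, hε, h⟩

/-- The slope of a sector around `y` that avoids the rays from the other points of `Q`. -/
def slope {Q : Set ℂ} (hQ : IsGeneric Q) (y : Q) : ℝ := (exists_sector hQ y.2).choose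

theorem slope_pos {Q : Set ℂ} (hQ : IsGeneric Q) (y : Q) : 0 < slope hQ y :=
  (exists_sector hQ y.2).choose_spec.1

theorem disjoint_sector {Q : Set ℂ} (hQ : IsGeneric Q) (y : Q) {z : ℂ} (hz : z ∈ Q)
    (hne : z ≠ y) {w : ℂ} (hw : w ∈ sector y (slope hQ y)) : w ∉ ray z :=
  Set.disjoint_left.1 ((exists_sector hQ y.2).choose_spec.2 z hz hne) hw

/-- The part of a sector around the half-line through `y` that lies beyond `y`. -/
def wedge {Q : Set ℂ} (hQ : IsGeneric Q) (y : Q) : Set ℂ :=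
  {w | w ∈ sector y (slope hQ y) ∧ 1 < (w / y).re}

theorem isOpen_wedge {Q : Set ℂ} (hQ : IsGeneric Q) (y : Q) : IsOpen (wedge hQ y) :=
  (isOpen_lt (continuous_div_im (y : ℂ)).abs
    (continuous_const.mul (continuous_div_re (y : ℂ)))).inter
    (isOpen_lt continuous_const (continuous_div_re (y : ℂ)))

theorem convex_wedge {Q : Set ℂ} (hQ : IsGeneric Q) (y : Q) : Convex ℝ (wedge hQ y) := by
  rintro p ⟨hp1, hp2⟩ q ⟨hq1, hq2⟩ a b ha hb hab
  simp only [wedge, sector, Set.mem_ofPred_eq, div_re_comb, div_im_comb, abs_lt] at *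
  obtain rfl : b = 1 - a := by linarith
  rcases ha.lt_or_eq with h | rfl
  · refine ⟨⟨?_, ?_⟩, ?_⟩ <;> nlinarith
  · simpa using ⟨hq1, hq2⟩

theorem mem_starDomain_of_mem_sector {Q : Set ℂ} (hQ : IsGeneric Q) {y : Q} {w : ℂ}
    (hw : w ∈ sector y (slope hQ y)) (h : (w / y).re < 1 ∨ (w / y).im ≠ 0) :
    w ∈ starDomain Q := by
  intro z hz hwz
  by_cases hne : z = y
  · subst hne
    rcases h with h | h
    · exact absurd hwz.1 (not_le.2 h)
    · exact h hwz.2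
  · exact disjoint_sector hQ y hz hne hw hwz

theorem wedge_subset {Q : Set ℂ} (hQ : IsGeneric Q) (y : Q) : wedge hQ y ⊆ Qᶜ := by
  intro w hw hwQ
  by_cases hne : w = y
  · have := hw.2
    rw [hne, div_self (hQ.ne_zero y.2), Complex.one_re] at this
    exact lt_irrefl _ this
  · exact disjoint_sector hQ y hwQ hne hw.1 (self_mem_ray (hQ.ne_zero hwQ))

theorem mem_sector_of_mem_ray {Q : Set ℂ} (hQ : IsGeneric Q) {y : Q} {w : ℂ} (hw : w ∈ ray y) :
    w ∈ sector y (slope hQ y) := by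
  have := slope_pos hQ y
  have := hw.1
  simp only [sector, Set.mem_ofPred_eq, hw.2, abs_zero]
  positivity

theorem mem_wedge_of_mem_ray {Q : Set ℂ} (hQ : IsGeneric Q) {y : Q} {w : ℂ} (hwQ : w ∉ Q)
    (hw : w ∈ ray y) : w ∈ wedge hQ y := by
  refine ⟨mem_sector_of_mem_ray hQ hw, lt_of_le_of_ne hw.1 fun h => hwQ ?_⟩
  have h1 : w / y = 1 := Complex.ext (by simp [← h]) (by simp [hw.2])
  rw [div_eq_one_iff_eq (hQ.ne_zero y.2)] at h1
  exact h1 ▸ y.2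

theorem eq_of_mem_ray_of_mem_sector {Q : Set ℂ} (hQ : IsGeneric Q) {y z : Q} {w : ℂ}
    (hw : w ∈ sector y (slope hQ y)) (hz : w ∈ ray z) : z = y := by
  by_contra h
  exact disjoint_sector hQ y z.2 (fun h' => h (Subtype.ext h')) hw hz

/-! ### The small circle around a puncture -/

theorem lassoRatio_le_half {Q : Set ℂ} (hQ : IsGeneric Q) {y : ℂ} (hy : y ∈ Q) :
    lassoRatio Q y ≤ 1 / 2 := by
  have hy0 : 0 < ‖y‖ := norm_pos_iff.2 (hQ.ne_zero hy)
  have h1 : Metric.infDist y (insert 0 (Q \ {y})) ≤ dist y 0 :=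
    Metric.infDist_le_dist_of_mem (Set.mem_insert _ _)
  rw [dist_zero_right] at h1
  have h2 := lassoRatio_mul_norm hQ hy
  by_contra! h
  nlinarith

/-- The ratio of a circle around `y` so small that it lies in the sector around `y`. -/
def smallRatio {Q : Set ℂ} (hQ : IsGeneric Q) (y : Q) : ℝ :=
  min (lassoRatio Q y) (slope hQ y / 4)

theorem smallRatio_pos {Q : Set ℂ} (hQ : IsGeneric Q) (y : Q) : 0 < smallRatio hQ y :=
  lt_min (lassoRatio_pos hQ y.2) (by have := slope_pos hQ y; linarith)

theorem circlePath_div_re {y : ℂ} (hy : y ≠ 0) (ρ : ℝ) (t : I) :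
    (circlePath y ρ t / y).re = 1 - ρ * Real.cos (2 * Real.pi * t) := by
  have : circlePath y ρ t / y
      = 1 - ρ * Complex.exp ((2 * Real.pi * (t : ℝ) : ℝ) * Complex.I) := by
    simp [circlePath, hy]
  rw [this, Complex.sub_re, Complex.re_ofReal_mul, Complex.exp_ofReal_mul_I_re, Complex.one_re]

theorem circlePath_div_im {y : ℂ} (hy : y ≠ 0) (ρ : ℝ) (t : I) :
    (circlePath y ρ t / y).im = -(ρ * Real.sin (2 * Real.pi * t)) := by
  have : circlePath y ρ t / y
      = 1 - ρ * Complex.exp ((2 * Real.pi * (t : ℝ) : ℝ) * Complex.I) := by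
    simp [circlePath, hy]
  rw [this, Complex.sub_im, Complex.im_ofReal_mul, Complex.exp_ofReal_mul_I_im, Complex.one_im,
    zero_sub]

/-- The ratio is at most `1 / 2`, so the real part stays at least `1 / 2`, while the imaginary part
is at most a quarter of the slope. -/
theorem circlePath_mem_sector {Q : Set ℂ} (hQ : IsGeneric Q) (y : Q) (t : I) :
    circlePath y (smallRatio hQ y) t ∈ sector y (slope hQ y) := by
  have h0 := smallRatio_pos hQ y
  have h1 : smallRatio hQ y ≤ 1 / 2 := (min_le_left _ _).trans (lassoRatio_le_half hQ y.2)
  have h2 : smallRatio hQ y ≤ slope hQ y / 4 := min_le_right _ _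
  have hs := slope_pos hQ y
  rw [sector, Set.mem_ofPred_eq, circlePath_div_re (hQ.ne_zero y.2),
    circlePath_div_im (hQ.ne_zero y.2), abs_neg, abs_mul, abs_of_pos h0]
  have hc := Real.cos_le_one (2 * Real.pi * t)
  have hsin := Real.abs_sin_le_one (2 * Real.pi * t)
  generalize Real.cos (2 * Real.pi * t) = C at *
  generalize |Real.sin (2 * Real.pi * t)| = S at *
  have h3 : smallRatio hQ y * S ≤ slope hQ y / 4 := by nlinarith
  have h4 : 1 / 2 ≤ 1 - smallRatio hQ y * C := by nlinarith
  nlinarith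

theorem circlePath_re_gt {y : ℂ} (hy : y ≠ 0) {ρ : ℝ} (hρ : 0 < ρ) {t : I}
    (h1 : (1 : ℝ) / 3 ≤ t) (h2 : (t : ℝ) ≤ 2 / 3) : 1 < (circlePath y ρ t / y).re := by
  rw [circlePath_div_re hy]
  have := Real.pi_pos
  have := Real.cos_neg_of_pi_div_two_lt_of_lt (x := 2 * Real.pi * t) (by nlinarith) (by nlinarith)
  nlinarith

theorem circlePath_im_neg {y : ℂ} (hy : y ≠ 0) {ρ : ℝ} (hρ : 0 < ρ) {t : I}
    (h1 : (0 : ℝ) < t) (h2 : (t : ℝ) < 1 / 2) : (circlePath y ρ t / y).im < 0 := by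
  rw [circlePath_div_im hy]
  have := Real.pi_pos
  have := Real.sin_pos_of_pos_of_lt_pi (x := 2 * Real.pi * t) (by positivity) (by nlinarith)
  nlinarith

theorem circlePath_im_pos {y : ℂ} (hy : y ≠ 0) {ρ : ℝ} (hρ : 0 < ρ) {t : I}
    (h1 : (1 : ℝ) / 2 < t) (h2 : (t : ℝ) < 1) : 0 < (circlePath y ρ t / y).im := by
  rw [circlePath_div_im hy]
  have := Real.pi_pos
  have := Real.sin_neg_of_neg_of_neg_pi_lt (x := 2 * Real.pi * t - 2 * Real.pi)
    (by nlinarith) (by nlinarith)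
  rw [Real.sin_sub_two_pi] at this
  nlinarith

open Path.Homotopic.Quotient (mk)

theorem smul_mem_sector {Q : Set ℂ} (hQ : IsGeneric Q) (y : Q) {s : ℝ} (hs : 0 < s) :
    s • (y : ℂ) ∈ sector y (slope hQ y) := by
  have := slope_pos hQ y
  have h : (s • (y : ℂ)) / y = (s : ℂ) := by
    rw [Complex.real_smul, mul_div_assoc, div_self (hQ.ne_zero y.2), mul_one]
  rw [sector, Set.mem_ofPred_eq, h, Complex.ofReal_re, Complex.ofReal_im, abs_zero]
  positivity

theorem smul_mem_starDomain {Q : Set ℂ} (hQ : IsGeneric Q) (y : Q) {s : ℝ} (hs0 : 0 ≤ s)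
    (hs : s < 1) : s • (y : ℂ) ∈ starDomain Q := by
  rcases hs0.eq_or_lt with rfl | h0
  · simpa using zero_mem_starDomain Q
  · refine mem_starDomain_of_mem_sector hQ (smul_mem_sector hQ y h0) (Or.inl ?_)
    rw [Complex.real_smul, mul_div_assoc, div_self (hQ.ne_zero y.2), mul_one]
    simpa using hs

/-! ### Shrinking a lasso -/

theorem circlePath_notMem_of_le {Q : Set ℂ} (hQ : IsGeneric Q) (y : Q) {r : ℝ} (hr0 : 0 < r)
    (hr : r ≤ lassoRatio Q y) (t : I) : circlePath y r t ∈ Qᶜ := by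
  intro hw
  have hy0 : 0 < ‖(y : ℂ)‖ := norm_pos_iff.2 (hQ.ne_zero y.2)
  have hmul := lassoRatio_mul_norm hQ y.2
  have hd : dist (y : ℂ) (circlePath y r t) = r * ‖(y : ℂ)‖ := by
    have h1 : y - circlePath y r t
        = r * Complex.exp ((2 * Real.pi * (t : ℝ) : ℝ) * Complex.I) * y := by
      simp [circlePath]
      ring
    rw [dist_eq_norm, h1, norm_mul, norm_mul, Complex.norm_exp_ofReal_mul_I, mul_one,
      Complex.norm_real, Real.norm_of_nonneg hr0.le]
  have hpos := mul_pos hr0 hy0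
  have hne : circlePath y r t ≠ y := by
    intro h
    rw [h, dist_self] at hd
    linarith
  have h2 : Metric.infDist (y : ℂ) (insert 0 (Q \ {(y : ℂ)})) ≤ dist (y : ℂ) (circlePath y r t) :=
    Metric.infDist_le_dist_of_mem (Set.mem_insert_of_mem _ ⟨hw, hne⟩)
  nlinarith

theorem segment_mem_starDomain {Q : Set ℂ} (hQ : IsGeneric Q) (y : Q) {r : ℝ} (hr0 : 0 < r)
    (hr1 : r ≤ 1) (t : I) : Path.segment 0 ((1 - r : ℂ) * y) t ∈ starDomain Q := by
  have h : Path.segment 0 ((1 - r : ℂ) * y) t = ((t : ℝ) * (1 - r)) • (y : ℂ) := by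
    simp [AffineMap.lineMap_apply]
    ring
  rw [h]
  have := t.2.1
  have := t.2.2
  exact smul_mem_starDomain hQ y (mul_nonneg t.2.1 (by linarith)) (by nlinarith)

theorem lasso_notMem_of_le {Q : Set ℂ} (hQ : IsGeneric Q) (y : Q) {r : ℝ} (hr0 : 0 < r)
    (hr : r ≤ lassoRatio Q y) (t : I) : lasso y r t ∈ Qᶜ := by
  have h1 : r ≤ 1 := hr.trans (lassoRatio_lt_one hQ y.2).le
  have hs := fun t => starDomain_subset hQ (segment_mem_starDomain hQ y hr0 h1 t)
  exact trans_mem hs (trans_mem (circlePath_notMem_of_le hQ y hr0 hr) fun _ => hs _) t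

theorem continuous_lasso (y : ℂ) : Continuous fun p : ℝ × I => lasso y p.1 p.2 := by
  have hs : Continuous fun p : ℝ × I => Path.segment 0 ((1 - p.1 : ℂ) * y) p.2 := by
    simp only [Path.segment, AffineMap.lineMap_apply, Path.coe_mk', ContinuousMap.coe_mk]
    simp only [vsub_eq_sub, vadd_eq_add, Complex.real_smul]
    fun_prop
  have hs' : Continuous fun p : ℝ × I => (Path.segment 0 ((1 - p.1 : ℂ) * y)).symm p.2 :=
    hs.comp (f := fun p : ℝ × I => (p.1, σ p.2)) (by fun_prop)
  have hc : Continuous fun p : ℝ × I => circlePath y p.1 p.2 := by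
    simp only [circlePath, Path.coe_mk', ContinuousMap.coe_mk]
    fun_prop
  have hcs := Path.trans_continuous_family (fun r : ℝ => circlePath y r) hc
    (fun r => (Path.segment 0 ((1 - r : ℂ) * y)).symm) hs'
  exact Path.trans_continuous_family (fun r : ℝ => Path.segment 0 ((1 - r : ℂ) * y)) hs
    (fun r => (circlePath y r).trans (Path.segment 0 ((1 - r : ℂ) * y)).symm) hcs

/-- No circle of ratio at most `lassoRatio` meets `Q`, so the ratio can be interpolated linearly.
This allows a circle small enough to fit in the sector. -/
theorem lasso_homotopic {Q : Set ℂ} (hQ : IsGeneric Q) (y : Q) {r s : ℝ} (hr0 : 0 < r)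
    (hr : r ≤ lassoRatio Q y) (hs0 : 0 < s) (hs : s ≤ lassoRatio Q y) :
    (restrictPath (lasso y r) (lasso_notMem_of_le hQ y hr0 hr)).Homotopic
      (restrictPath (lasso y s) (lasso_notMem_of_le hQ y hs0 hs)) := by
  have hmem : ∀ u : I, 0 < r + u * (s - r) ∧ r + u * (s - r) ≤ lassoRatio Q y := by
    intro u
    have := u.2.1
    have := u.2.2
    rcases le_total r s with h | h
    · constructor <;> nlinarith
    · constructor <;> nlinarith
  refine ⟨{ toFun := fun p => ⟨lasso y (r + (p.1 : ℝ) * (s - r)) p.2,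
              lasso_notMem_of_le hQ y (hmem p.1).1 (hmem p.1).2 p.2⟩
            continuous_toFun := ?_
            map_zero_left := fun t => ?_
            map_one_left := fun t => ?_
            prop' := fun u t ht => ?_ }⟩
  · exact ((continuous_lasso (y : ℂ)).comp
      (f := fun p : I × I => (r + (p.1 : ℝ) * (s - r), p.2)) (by fun_prop)).subtype_mk _
  · exact Subtype.ext (by simp [restrictPath])
  · exact Subtype.ext (by simp [restrictPath])
  · rcases ht with rfl | rfl <;> exact Subtype.ext (by simp [restrictPath])

/-! ### Classes of words -/

/-- The homotopy class of loops represented by a word. -/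
def wordClass {Q : Set ℂ} (hQ : IsGeneric Q) (g : FreeGroup Q) :
    Path.Homotopic.Quotient (⟨0, hQ.zero_notMem⟩ : (Qᶜ : Set ℂ)) ⟨0, hQ.zero_notMem⟩ :=
  (straightHom hQ g).unop

theorem wordClass_mul {Q : Set ℂ} (hQ : IsGeneric Q) (g h : FreeGroup Q) :
    wordClass hQ (g * h) = (wordClass hQ g).trans (wordClass hQ h) := by
  rw [wordClass, map_mul, MulOpposite.unop_mul, FundamentalGroup.mul_def]
  rfl

theorem wordClass_one {Q : Set ℂ} (hQ : IsGeneric Q) :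
    wordClass hQ 1 = Path.Homotopic.Quotient.refl _ := by
  rw [wordClass, map_one, MulOpposite.unop_one, FundamentalGroup.one_def]

theorem wordClass_of {Q : Set ℂ} (hQ : IsGeneric Q) (y : Q) :
    wordClass hQ (FreeGroup.of y) = mk (restrictPath (lasso y (smallRatio hQ y))
      (lasso_notMem_of_le hQ y (smallRatio_pos hQ y) (min_le_left _ _))) := by
  rw [wordClass, straightHom, FreeGroup.lift_apply_of]
  exact Path.Homotopic.Quotient.eq.2 (lasso_homotopic hQ y (lassoRatio_pos hQ y.2) le_rfl
    (smallRatio_pos hQ y) (min_le_left _ _))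

/-! ### Splitting the lasso -/

theorem mk_eq_trans_subpath {X : Type*} [TopologicalSpace X] {a b : X} (p : Path a b) (s t : I) :
    mk p = (mk ((p.subpath 0 s).cast p.source.symm rfl)).trans
      ((mk (p.subpath s t)).trans
        (mk ((p.subpath t 1).cast rfl p.target.symm))) := by
  have h : ((p.subpath 0 s).trans ((p.subpath s t).trans (p.subpath t 1))).Homotopic
      (p.subpath 0 1) :=
    (Path.Homotopic.hcomp (.refl _) ⟨Path.Homotopy.subpathTransSubpath p s t 1⟩).trans
      ⟨Path.Homotopy.subpathTransSubpath p 0 s 1⟩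
  have h' := Path.Homotopic.Quotient.eq.2 (h.pathCast p.source.symm p.target.symm)
  rw [Path.subpath_zero_one] at h'
  exact h'.symm

theorem trans_regroup {X : Type*} [TopologicalSpace X] {a b c d e f : X}
    (α : Path.Homotopic.Quotient a b) (β₁ : Path.Homotopic.Quotient b c)
    (β₂ : Path.Homotopic.Quotient c d) (β₃ : Path.Homotopic.Quotient d e)
    (α' : Path.Homotopic.Quotient e f) :
    α.trans ((β₁.trans (β₂.trans β₃)).trans α') =
      (α.trans β₁).trans (β₂.trans (β₃.trans α')) := by
  simp only [Path.Homotopic.Quotient.trans_assoc]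

/-- The small circle around `y`. -/
def smallCircle {Q : Set ℂ} (hQ : IsGeneric Q) (y : Q) :=
  restrictPath (circlePath y (smallRatio hQ y))
    (circlePath_notMem_of_le hQ y (smallRatio_pos hQ y) (min_le_left _ _))

/-- The point of the interval at one third of the way. -/
def third : I := ⟨1 / 3, by norm_num, by norm_num⟩

/-- The point of the interval at two thirds of the way. -/
def twoThirds : I := ⟨2 / 3, by norm_num, by norm_num⟩

/-- A point beyond `y` on the right of the ray from `y`. -/
def rightPt {Q : Set ℂ} (hQ : IsGeneric Q) (y : Q) : (Qᶜ : Set ℂ) := smallCircle hQ y third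

/-- A point beyond `y` on the left of the ray from `y`. -/
def leftPt {Q : Set ℂ} (hQ : IsGeneric Q) (y : Q) : (Qᶜ : Set ℂ) := smallCircle hQ y twoThirds

theorem smallCircle_mem_wedge {Q : Set ℂ} (hQ : IsGeneric Q) (y : Q) {t : I}
    (h1 : (1 : ℝ) / 3 ≤ t) (h2 : (t : ℝ) ≤ 2 / 3) : (smallCircle hQ y t : ℂ) ∈ wedge hQ y :=
  ⟨circlePath_mem_sector hQ y t,
    circlePath_re_gt (hQ.ne_zero y.2) (smallRatio_pos hQ y) h1 h2⟩

theorem rightPt_mem_wedge {Q : Set ℂ} (hQ : IsGeneric Q) (y : Q) :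
    (rightPt hQ y : ℂ) ∈ wedge hQ y :=
  smallCircle_mem_wedge hQ y le_rfl (by norm_num [third])

theorem leftPt_mem_wedge {Q : Set ℂ} (hQ : IsGeneric Q) (y : Q) :
    (leftPt hQ y : ℂ) ∈ wedge hQ y :=
  smallCircle_mem_wedge hQ y (by norm_num [twoThirds]) le_rfl

theorem rightPt_im {Q : Set ℂ} (hQ : IsGeneric Q) (y : Q) : ((rightPt hQ y : ℂ) / y).im < 0 :=
  circlePath_im_neg (hQ.ne_zero y.2) (smallRatio_pos hQ y) (by norm_num [third])
    (by norm_num [third])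

theorem leftPt_im {Q : Set ℂ} (hQ : IsGeneric Q) (y : Q) : 0 < ((leftPt hQ y : ℂ) / y).im :=
  circlePath_im_pos (hQ.ne_zero y.2) (smallRatio_pos hQ y) (by norm_num [twoThirds])
    (by norm_num [twoThirds])

theorem mem_starDomain_of_mem_wedge {Q : Set ℂ} (hQ : IsGeneric Q) {y : Q} {w : ℂ}
    (hw : w ∈ wedge hQ y) (h : (w / y).im ≠ 0) : w ∈ starDomain Q :=
  mem_starDomain_of_mem_sector hQ hw.1 (Or.inr h)

/-- The segment from the origin to a point of the star-shaped domain. -/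
def starPath {Q : Set ℂ} (hQ : IsGeneric Q) (b : (Qᶜ : Set ℂ)) (hb : (b : ℂ) ∈ starDomain Q) :
    Path (⟨0, hQ.zero_notMem⟩ : (Qᶜ : Set ℂ)) b :=
  segPath _ b (((starConvex_starDomain Q).segment_subset hb).trans (starDomain_subset hQ))

theorem starPath_mem {Q : Set ℂ} (hQ : IsGeneric Q) {b : (Qᶜ : Set ℂ)}
    (hb : (b : ℂ) ∈ starDomain Q) (t : I) : (starPath hQ b hb t : ℂ) ∈ starDomain Q :=
  segPath_mem _ ((starConvex_starDomain Q).segment_subset hb) t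

/-- The segment between two points of a wedge. -/
def wedgePath {Q : Set ℂ} (hQ : IsGeneric Q) (y : Q) (a b : (Qᶜ : Set ℂ))
    (ha : (a : ℂ) ∈ wedge hQ y) (hb : (b : ℂ) ∈ wedge hQ y) : Path a b :=
  segPath a b (((convex_wedge hQ y).segment_subset ha hb).trans (wedge_subset hQ y))

theorem wedgePath_mem {Q : Set ℂ} (hQ : IsGeneric Q) {y : Q} {a b : (Qᶜ : Set ℂ)}
    (ha : (a : ℂ) ∈ wedge hQ y) (hb : (b : ℂ) ∈ wedge hQ y) (t : I) :
    (wedgePath hQ y a b ha hb t : ℂ) ∈ wedge hQ y :=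
  segPath_mem _ ((convex_wedge hQ y).segment_subset ha hb) t

theorem mk_eq_of_mem_starDomain {Q : Set ℂ} (hQ : IsGeneric Q) {a b : (Qᶜ : Set ℂ)}
    {p q : Path a b} (hp : ∀ t, (p t : ℂ) ∈ starDomain Q) (hq : ∀ t, (q t : ℂ) ∈ starDomain Q) :
    mk p = mk q :=
  homotopic_of_starConvex (starConvex_starDomain Q) (starDomain_subset hQ) hp hq

theorem mk_eq_of_mem_wedge {Q : Set ℂ} (hQ : IsGeneric Q) {y : Q} {a b : (Qᶜ : Set ℂ)}
    {p q : Path a b} (hp : ∀ t, (p t : ℂ) ∈ wedge hQ y) (hq : ∀ t, (q t : ℂ) ∈ wedge hQ y) :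
    mk p = mk q :=
  homotopic_of_starConvex ((convex_wedge hQ y).starConvex (leftPt_mem_wedge hQ y))
    (wedge_subset hQ y) hp hq

theorem rightPt_mem_starDomain {Q : Set ℂ} (hQ : IsGeneric Q) (y : Q) :
    (rightPt hQ y : ℂ) ∈ starDomain Q :=
  mem_starDomain_of_mem_wedge hQ (rightPt_mem_wedge hQ y) (rightPt_im hQ y).ne

theorem leftPt_mem_starDomain {Q : Set ℂ} (hQ : IsGeneric Q) (y : Q) :
    (leftPt hQ y : ℂ) ∈ starDomain Q :=
  mem_starDomain_of_mem_wedge hQ (leftPt_mem_wedge hQ y) (leftPt_im hQ y).ne'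

/-- The circle meets the ray of `y` only at its midpoint, and the sector keeps it off the other
rays. -/
theorem smallCircle_mem_starDomain {Q : Set ℂ} (hQ : IsGeneric Q) (y : Q) {t : I}
    (ht : (t : ℝ) < 1 / 2 ∨ (1 : ℝ) / 2 < t) : (smallCircle hQ y t : ℂ) ∈ starDomain Q := by
  refine mem_starDomain_of_mem_sector hQ (circlePath_mem_sector hQ y t) ?_
  have hr := smallRatio_pos hQ y
  have hy := hQ.ne_zero y.2
  change (circlePath y (smallRatio hQ y) t / y).re < 1 ∨
    (circlePath y (smallRatio hQ y) t / y).im ≠ 0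
  rcases ht with ht | ht
  · rcases t.2.1.eq_or_lt with h | h
    · left
      rw [circlePath_div_re hy, ← h]
      simpa using hr
    · exact Or.inr (circlePath_im_neg hy hr h ht).ne
  · rcases t.2.2.eq_or_lt with h | h
    · left
      rw [circlePath_div_re hy, h]
      simpa using hr
    · exact Or.inr (circlePath_im_pos hy hr ht h).ne'

/-- The class of a lasso goes straight to the right of the puncture, turns to its left in the
wedge, and comes straight back. -/
theorem wordClass_of_eq {Q : Set ℂ} (hQ : IsGeneric Q) (y : Q) :
    wordClass hQ (FreeGroup.of y) =
      (mk (starPath hQ (rightPt hQ y) (rightPt_mem_starDomain hQ y))).trans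
        ((mk (wedgePath hQ y (rightPt hQ y) (leftPt hQ y) (rightPt_mem_wedge hQ y)
          (leftPt_mem_wedge hQ y))).trans
          (mk (starPath hQ (leftPt hQ y) (leftPt_mem_starDomain hQ y))).symm) := by
  have hr0 := smallRatio_pos hQ y
  have hr1 : smallRatio hQ y ≤ 1 :=
    (min_le_left _ _).trans (lassoRatio_lt_one hQ y.2).le
  have hseg := segment_mem_starDomain hQ y hr0 hr1
  let A := restrictPath (Path.segment 0 ((1 - smallRatio hQ y : ℂ) * y))
    fun t => starDomain_subset hQ (hseg t)
  let C := smallCircle hQ y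
  have h1 : wordClass hQ (FreeGroup.of y) =
      (mk A).trans ((mk C).trans (mk A).symm) := by
    rw [wordClass_of]
    refine congrArg mk ?_
    ext t
    simp only [lasso, restrictPath, A, C, smallCircle, Path.trans_apply, Path.coe_mk',
      ContinuousMap.coe_mk]
    split_ifs <;> rfl
  -- The middle third of the circle stays in the wedge; the outer thirds miss the rays and are
  -- absorbed into straight paths from the origin.
  have hC : mk C = (mk ((C.subpath 0 third).cast C.source.symm rfl)).trans
      ((mk (wedgePath hQ y (rightPt hQ y) (leftPt hQ y) (rightPt_mem_wedge hQ y)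
        (leftPt_mem_wedge hQ y))).trans
        (mk ((C.subpath twoThirds 1).cast rfl C.target.symm))) := by
    rw [mk_eq_trans_subpath C third twoThirds]
    congr 2
    refine mk_eq_of_mem_wedge hQ (y := y) (fun t => ?_) (wedgePath_mem hQ _ _)
    exact subpath_mem C (S := Subtype.val ⁻¹' wedge hQ y)
      (show (1 : ℝ) / 3 ≤ 2 / 3 by norm_num)
      (fun u hu1 hu2 => smallCircle_mem_wedge hQ y hu1 hu2) t
  have hA : (mk A).trans
      (mk ((C.subpath 0 third).cast C.source.symm rfl)) =
      mk (starPath hQ (rightPt hQ y) (rightPt_mem_starDomain hQ y)) := by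
    rw [← Path.Homotopic.Quotient.mk_trans]
    refine mk_eq_of_mem_starDomain hQ ?_ (starPath_mem hQ _)
    refine trans_mem (S := Subtype.val ⁻¹' starDomain Q) hseg ?_
    refine subpath_mem C (S := Subtype.val ⁻¹' starDomain Q) (show (0 : ℝ) ≤ 1 / 3 by norm_num)
      fun u hu1 hu2 => smallCircle_mem_starDomain hQ y (Or.inl ?_)
    have : (u : ℝ) ≤ 1 / 3 := hu2
    linarith
  have hB : (mk ((C.subpath twoThirds 1).cast rfl C.target.symm)).trans
      (mk A).symm =
      (mk (starPath hQ (leftPt hQ y) (leftPt_mem_starDomain hQ y))).symm := by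
    rw [← Path.Homotopic.Quotient.mk_symm, ← Path.Homotopic.Quotient.mk_symm, ← Path.Homotopic.Quotient.mk_trans]
    refine mk_eq_of_mem_starDomain hQ ?_ fun t => starPath_mem hQ (leftPt_mem_starDomain hQ y) _
    refine trans_mem (S := Subtype.val ⁻¹' starDomain Q) ?_ fun t => hseg _
    refine subpath_mem C (S := Subtype.val ⁻¹' starDomain Q) (show (2 : ℝ) / 3 ≤ 1 by norm_num)
      fun u hu1 hu2 => smallCircle_mem_starDomain hQ y (Or.inr ?_)
    have : (2 : ℝ) / 3 ≤ u := hu1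
    linarith
  rw [h1, hC, ← hA, ← hB]
  exact trans_regroup _ _ _ _ _

/-! ### Base paths and the words of path classes -/

theorem exists_mem_ray {Q : Set ℂ} {w : ℂ} (hw : w ∉ starDomain Q) : ∃ y : Q, w ∈ ray y := by
  simp only [starDomain, Set.mem_ofPred_eq, not_forall, not_not] at hw
  obtain ⟨y, hy, h⟩ := hw
  exact ⟨⟨y, hy⟩, h⟩

/-- The class from the origin to a point of the wedge beyond `y` that passes on the left of `y`. -/
def leftClass {Q : Set ℂ} (hQ : IsGeneric Q) (y : Q) (b : (Qᶜ : Set ℂ))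
    (hb : (b : ℂ) ∈ wedge hQ y) :
    Path.Homotopic.Quotient (⟨0, hQ.zero_notMem⟩ : (Qᶜ : Set ℂ)) b :=
  (mk (starPath hQ (leftPt hQ y) (leftPt_mem_starDomain hQ y))).trans
    (mk (wedgePath hQ y (leftPt hQ y) b (leftPt_mem_wedge hQ y) hb))

open Classical in
/-- The class of the straight path to a point of the star-shaped domain, or, for a point of a ray,
the class of the path that passes on the left of the puncture. -/
def baseClass {Q : Set ℂ} (hQ : IsGeneric Q) (b : (Qᶜ : Set ℂ)) :
    Path.Homotopic.Quotient (⟨0, hQ.zero_notMem⟩ : (Qᶜ : Set ℂ)) b :=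
  if h : (b : ℂ) ∈ starDomain Q then mk (starPath hQ b h)
  else leftClass hQ (exists_mem_ray h).choose b
    (mem_wedge_of_mem_ray hQ b.2 (exists_mem_ray h).choose_spec)

theorem baseClass_of_mem_starDomain {Q : Set ℂ} (hQ : IsGeneric Q) {b : (Qᶜ : Set ℂ)}
    (h : (b : ℂ) ∈ starDomain Q) : baseClass hQ b = mk (starPath hQ b h) := dif_pos h

theorem baseClass_of_mem_ray {Q : Set ℂ} (hQ : IsGeneric Q) {b : (Qᶜ : Set ℂ)} {y : Q}
    (h : (b : ℂ) ∈ ray y) :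
    baseClass hQ b = leftClass hQ y b (mem_wedge_of_mem_ray hQ b.2 h) := by
  have h' : (b : ℂ) ∉ starDomain Q := fun hs => hs y y.2 h
  rw [baseClass, dif_neg h']
  have : (exists_mem_ray h').choose = y :=
    eq_of_mem_ray_of_mem_sector hQ (mem_sector_of_mem_ray hQ h) (exists_mem_ray h').choose_spec
  congr

open Classical in
/-- The sheet over the wedge beyond `y` in the presentation of the universal cover cut along the
rays. -/
def sheet {Q : Set ℂ} (y : Q) (w : ℂ) : FreeGroup Q :=
  if 0 ≤ (w / y).im then 1 else FreeGroup.of y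

/-- Passing on the left of `y` agrees with the base path on and to the left of the ray; to the right
of it the two differ by exactly one lasso. -/
theorem wordClass_sheet_trans_leftClass {Q : Set ℂ} (hQ : IsGeneric Q) (y : Q)
    {b : (Qᶜ : Set ℂ)} (hb : (b : ℂ) ∈ wedge hQ y) :
    (wordClass hQ (sheet y b)).trans (leftClass hQ y b hb) = baseClass hQ b := by
  by_cases him : ((b : ℂ) / y).im = 0
  · have hray : (b : ℂ) ∈ ray y := ⟨hb.2.le, him⟩
    rw [sheet, if_pos him.ge, wordClass_one, Path.Homotopic.Quotient.refl_trans,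
      baseClass_of_mem_ray hQ hray]
  have hst := mem_starDomain_of_mem_wedge hQ hb him
  rw [baseClass_of_mem_starDomain hQ hst]
  rcases lt_or_gt_of_ne him with h | h
  · rw [sheet, if_neg (not_le.2 h), wordClass_of_eq, leftClass]
    simp only [Path.Homotopic.Quotient.trans_assoc]
    rw [← Path.Homotopic.Quotient.trans_assoc (Path.Homotopic.Quotient.symm _),
      Path.Homotopic.Quotient.symm_trans, Path.Homotopic.Quotient.refl_trans,
      ← Path.Homotopic.Quotient.mk_trans]
    have h1 : mk ((wedgePath hQ y (rightPt hQ y) (leftPt hQ y) (rightPt_mem_wedge hQ y)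
        (leftPt_mem_wedge hQ y)).trans (wedgePath hQ y (leftPt hQ y) b (leftPt_mem_wedge hQ y) hb))
        = mk (wedgePath hQ y (rightPt hQ y) b (rightPt_mem_wedge hQ y) hb) :=
      mk_eq_of_mem_wedge hQ (trans_mem (S := Subtype.val ⁻¹' wedge hQ y)
        (wedgePath_mem hQ _ _) (wedgePath_mem hQ _ _)) (wedgePath_mem hQ _ _)
    rw [h1, ← Path.Homotopic.Quotient.mk_trans]
    refine mk_eq_of_mem_starDomain hQ (trans_mem (S := Subtype.val ⁻¹' starDomain Q)
      (starPath_mem hQ _) fun t => ?_) (starPath_mem hQ _)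
    refine mem_starDomain_of_mem_wedge hQ (y := y) (wedgePath_mem hQ _ _ t) (ne_of_lt ?_)
    refine segPath_mem (S := {w : ℂ | (w / y).im < 0}) _ ?_ t
    refine Convex.segment_subset ?_ (rightPt_im hQ y) h
    intro p hp q hq α β hα hβ hαβ
    simp only [Set.mem_ofPred_eq, div_im_comb] at hp hq ⊢
    obtain rfl : β = 1 - α := by linarith
    rcases hα.lt_or_eq with h | rfl
    · nlinarith
    · simpa using hq
  · rw [sheet, if_pos h.le, wordClass_one, Path.Homotopic.Quotient.refl_trans, leftClass,
      ← Path.Homotopic.Quotient.mk_trans]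
    refine mk_eq_of_mem_starDomain hQ (trans_mem (S := Subtype.val ⁻¹' starDomain Q)
      (starPath_mem hQ _) fun t => ?_) (starPath_mem hQ _)
    refine mem_starDomain_of_mem_wedge hQ (y := y) (wedgePath_mem hQ _ _ t) (ne_of_gt ?_)
    refine segPath_mem (S := {w : ℂ | 0 < (w / y).im}) _ ?_ t
    refine Convex.segment_subset ?_ (leftPt_im hQ y) h
    intro p hp q hq α β hα hβ hαβ
    simp only [Set.mem_ofPred_eq, div_im_comb] at hp hq ⊢
    obtain rfl : β = 1 - α := by linarith
    rcases hα.lt_or_eq with h | rfl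
    · nlinarith
    · simpa using hq

/-- The word `g` represents the path class `c`, when its end points are joined to the origin by
the base paths. -/
def Represents {Q : Set ℂ} (hQ : IsGeneric Q) (g : FreeGroup Q) {a b : (Qᶜ : Set ℂ)}
    (c : Path.Homotopic.Quotient a b) : Prop :=
  (baseClass hQ a).trans c = (wordClass hQ g).trans (baseClass hQ b)

section Represents

variable {Q : Set ℂ} {hQ : IsGeneric Q} {a b c : (Qᶜ : Set ℂ)}

theorem Represents.trans {g h : FreeGroup Q} {α : Path.Homotopic.Quotient a b}
    {β : Path.Homotopic.Quotient b c} (hα : Represents hQ g α) (hβ : Represents hQ h β) :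
    Represents hQ (g * h) (α.trans β) := by
  unfold Represents at *
  rw [← Path.Homotopic.Quotient.trans_assoc, hα, Path.Homotopic.Quotient.trans_assoc, hβ,
    wordClass_mul, Path.Homotopic.Quotient.trans_assoc]

theorem represents_refl (a : (Qᶜ : Set ℂ)) :
    Represents hQ 1 (Path.Homotopic.Quotient.refl a) := by
  simp [Represents, wordClass_one]

theorem Represents.symm {g : FreeGroup Q} {α : Path.Homotopic.Quotient a b}
    (hα : Represents hQ g α) : Represents hQ g⁻¹ α.symm := by
  unfold Represents at *
  have h : (wordClass hQ g⁻¹).trans ((baseClass hQ a).trans α) = baseClass hQ b := by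
    rw [hα, ← Path.Homotopic.Quotient.trans_assoc, ← wordClass_mul, inv_mul_cancel,
      wordClass_one, Path.Homotopic.Quotient.refl_trans]
  rw [← h]
  simp

theorem represents_cast {a' b' : (Qᶜ : Set ℂ)} {g : FreeGroup Q}
    {α : Path.Homotopic.Quotient a b} (ha : a' = a) (hb : b' = b) :
    Represents hQ g (α.cast ha hb) ↔ Represents hQ g α := by
  subst ha hb
  simp

theorem represents_of_mem_starDomain {p : Path a b} (hp : ∀ t, (p t : ℂ) ∈ starDomain Q) :
    Represents hQ 1 (mk p) := by
  have ha : (a : ℂ) ∈ starDomain Q := by simpa using hp 0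
  have hb : (b : ℂ) ∈ starDomain Q := by simpa using hp 1
  rw [Represents, wordClass_one, Path.Homotopic.Quotient.refl_trans,
    baseClass_of_mem_starDomain hQ ha, baseClass_of_mem_starDomain hQ hb,
    ← Path.Homotopic.Quotient.mk_trans]
  exact mk_eq_of_mem_starDomain hQ (trans_mem (S := Subtype.val ⁻¹' starDomain Q)
    (starPath_mem hQ _) hp) (starPath_mem hQ _)

/-- The wedge is convex, so only the sides of the two end points matter: the word is `y` for a
passage from right to left, its inverse for the opposite, and trivial otherwise. -/
theorem represents_of_mem_wedge {y : Q} {p : Path a b} (hp : ∀ t, (p t : ℂ) ∈ wedge hQ y) :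
    Represents hQ (sheet y a * (sheet y b)⁻¹) (mk p) := by
  have ha : (a : ℂ) ∈ wedge hQ y := by simpa using hp 0
  have hb : (b : ℂ) ∈ wedge hQ y := by simpa using hp 1
  have h : (leftClass hQ y a ha).trans (mk p) = leftClass hQ y b hb := by
    rw [leftClass, leftClass, Path.Homotopic.Quotient.trans_assoc,
      ← Path.Homotopic.Quotient.mk_trans]
    congr 1
    exact mk_eq_of_mem_wedge hQ (trans_mem (S := Subtype.val ⁻¹' wedge hQ y)
      (wedgePath_mem hQ _ _) hp) (wedgePath_mem hQ _ _)
  rw [Represents, ← wordClass_sheet_trans_leftClass hQ y ha,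
    ← wordClass_sheet_trans_leftClass hQ y hb, Path.Homotopic.Quotient.trans_assoc, h,
    ← Path.Homotopic.Quotient.trans_assoc, ← wordClass_mul, inv_mul_cancel_right]

theorem sheet_mem_closure {S : Set Q} {y : Q} (hy : y ∈ S) (w : ℂ) :
    sheet y w ∈ Subgroup.closure (FreeGroup.of '' S) := by
  unfold sheet
  split_ifs
  · exact one_mem _
  · exact Subgroup.subset_closure ⟨y, hy, rfl⟩

/-- A path that meets only the rays of the letters in `S` is represented by a word in `S`. -/
theorem exists_represents (hQ : IsGeneric Q) {S : Set Q} (p : Path a b)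
    (hp : ∀ t, ∀ y ∉ S, (p t : ℂ) ∉ ray y) :
    ∃ g ∈ Subgroup.closure (FreeGroup.of '' S), Represents hQ g (mk p) := by
  let c : Option S → Set I := fun i => i.elim {t | (p t : ℂ) ∈ starDomain Q}
    fun y => {t | (p t : ℂ) ∈ wedge hQ y}
  have hpc : Continuous fun t => (p t : ℂ) := continuous_subtype_val.comp p.continuous
  have hopen : ∀ i, IsOpen (c i) := by
    rintro (_ | y)
    · exact (isOpen_starDomain hQ).preimage hpc
    · exact (isOpen_wedge hQ y).preimage hpc
  have hcov : Set.univ ⊆ ⋃ i, c i := by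
    intro t _
    rw [Set.mem_iUnion]
    by_cases h : (p t : ℂ) ∈ starDomain Q
    · exact ⟨none, h⟩
    · obtain ⟨y, hy⟩ := exists_mem_ray h
      have hyS : y ∈ S := by
        by_contra hyS
        exact hp t y hyS hy
      exact ⟨some ⟨y, hyS⟩, mem_wedge_of_mem_ray hQ (p t).2 hy⟩
  -- A Lebesgue subdivision cuts the path into steps that stay in the star-shaped domain or in the
  -- wedge of a letter of `S`.
  obtain ⟨t, ht0, hmono, ⟨N, hN⟩, ht⟩ :=
    exists_monotone_Icc_subset_open_cover_unitInterval hopen hcov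
  have key : ∀ n, ∃ g ∈ Subgroup.closure (FreeGroup.of '' S),
      Represents hQ g (mk (p.subpath (t 0) (t n))) := by
    intro n
    induction n with
    | zero => exact ⟨1, one_mem _, by simpa using represents_refl _⟩
    | succ n ih =>
      obtain ⟨g, hg, hgr⟩ := ih
      have hstep : ∃ h ∈ Subgroup.closure (FreeGroup.of '' S),
          Represents hQ h (mk (p.subpath (t n) (t (n + 1)))) := by
        obtain ⟨i, hi⟩ := ht n
        rcases i with _ | y
        · exact ⟨1, one_mem _, represents_of_mem_starDomain
            (subpath_mem p (S := Subtype.val ⁻¹' starDomain Q) (hmono n.le_succ)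
              fun u h1 h2 => hi ⟨h1, h2⟩)⟩
        · exact ⟨_, mul_mem (sheet_mem_closure y.2 _) (inv_mem (sheet_mem_closure y.2 _)),
            represents_of_mem_wedge (y := y.1)
              (subpath_mem p (S := Subtype.val ⁻¹' wedge hQ y) (hmono n.le_succ)
                fun u h1 h2 => hi ⟨h1, h2⟩)⟩
      obtain ⟨h, hh, hhr⟩ := hstep
      refine ⟨g * h, mul_mem hg hh, ?_⟩
      rw [← mk_subpath_trans p (t 0) (t n) (t (n + 1))]
      exact hgr.trans hhr
  obtain ⟨g, hg, hgr⟩ := key N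
  rw [ht0, hN N le_rfl, Path.subpath_zero_one, Path.Homotopic.Quotient.mk_cast,
    represents_cast] at hgr
  exact ⟨g, hg, hgr⟩

/-- At the origin the base path is trivial, so for a loop based there representing means being
equal. -/
theorem Represents.eq_wordClass {g : FreeGroup Q}
    {α : Path.Homotopic.Quotient (⟨0, hQ.zero_notMem⟩ : (Qᶜ : Set ℂ)) ⟨0, hQ.zero_notMem⟩}
    (h : Represents hQ g α) : α = wordClass hQ g := by
  have h0 : baseClass hQ (⟨0, hQ.zero_notMem⟩ : (Qᶜ : Set ℂ)) = .refl _ := by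
    rw [baseClass_of_mem_starDomain hQ (zero_mem_starDomain Q)]
    exact mk_eq_of_mem_starDomain hQ (starPath_mem hQ _) fun _ => zero_mem_starDomain Q
  simpa [Represents, h0] using h

end Represents

/-! ### The covering by words, and injectivity -/

section Covering

variable {Q : Set ℂ} (hQ : IsGeneric Q)

/-- The charts of the punctured plane: the star-shaped domain and the wedges. -/
def chart : Option Q → Set (Qᶜ : Set ℂ)
  | none => Subtype.val ⁻¹' starDomain Q
  | some y => Subtype.val ⁻¹' wedge hQ y

/-- The sheet over a point of a chart. -/
def chartSheet : Option Q → ℂ → FreeGroup Q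
  | none, _ => 1
  | some y, w => sheet y w

theorem isOpen_chart (i : Option Q) : IsOpen (chart hQ i) := by
  rcases i with _ | y
  · exact (isOpen_starDomain hQ).preimage continuous_subtype_val
  · exact (isOpen_wedge hQ y).preimage continuous_subtype_val

theorem exists_mem_chart (b : (Qᶜ : Set ℂ)) : ∃ i, b ∈ chart hQ i := by
  by_cases h : (b : ℂ) ∈ starDomain Q
  · exact ⟨none, h⟩
  · obtain ⟨y, hy⟩ := exists_mem_ray h
    exact ⟨some y, mem_wedge_of_mem_ray hQ b.2 hy⟩

theorem im_ne_zero_of_mem_chart {y : Q} {j : Option Q} (hne : some y ≠ j) {b : (Qᶜ : Set ℂ)}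
    (hy : b ∈ chart hQ (some y)) (hj : b ∈ chart hQ j) : ((b : ℂ) / y).im ≠ 0 := by
  intro him
  have hray : (b : ℂ) ∈ ray y := ⟨hy.2.le, him⟩
  rcases j with _ | z
  · exact hj y y.2 hray
  · exact hne (congrArg some (eq_of_mem_ray_of_mem_sector hQ hj.1 hray))

/-- The sheet over a wedge jumps only on its ray, and no point of that ray belongs to another chart.
-/
theorem eventually_chartSheet_eq {i j : Option Q} (hne : i ≠ j) {b : (Qᶜ : Set ℂ)}
    (hi : b ∈ chart hQ i) (hj : b ∈ chart hQ j) :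
    ∀ᶠ w : (Qᶜ : Set ℂ) in nhds b, chartSheet i (w : ℂ) = chartSheet i (b : ℂ) := by
  rcases i with _ | y
  · exact Filter.Eventually.of_forall fun _ => rfl
  have him := im_ne_zero_of_mem_chart hQ hne hi hj
  have hc : Continuous fun w : (Qᶜ : Set ℂ) => ((w : ℂ) / y).im :=
    (continuous_div_im (y : ℂ)).comp continuous_subtype_val
  rcases lt_or_gt_of_ne him with h | h
  · filter_upwards [hc.continuousAt.eventually_lt continuousAt_const h] with w hw
    simp only [chartSheet, sheet, if_neg (not_le.2 hw), if_neg (not_le.2 h)]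
  · filter_upwards [continuousAt_const.eventually_lt hc.continuousAt h] with w hw
    simp only [chartSheet, sheet, if_pos hw.le, if_pos h.le]

instance : TopologicalSpace (FreeGroup Q) := ⊥

instance : DiscreteTopology (FreeGroup Q) := ⟨rfl⟩

/-- The bundle over the punctured plane whose fibre is the free group on the punctures, and whose
sheets are glued along the rays. -/
def wordCore : FiberBundleCore (Option Q) (Qᶜ : Set ℂ) (FreeGroup Q) where
  baseSet := chart hQ
  isOpen_baseSet := isOpen_chart hQ
  indexAt b := (exists_mem_chart hQ b).choose
  mem_baseSet_at b := (exists_mem_chart hQ b).choose_spec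
  -- A coordinate `f` in chart `i` stands for the sheet `f * (chartSheet i b)⁻¹`, which does not
  -- depend on the chart. Multiplying on the right leaves room for a commuting left action of the
  -- free group.
  coordChange i j b f := f * (chartSheet i b)⁻¹ * chartSheet j b
  coordChange_self i b _ f := by simp
  continuousOn_coordChange i j := by
    by_cases hij : i = j
    · subst hij
      simpa using continuous_snd.continuousOn
    · rintro ⟨b, f⟩ ⟨⟨hi, hj⟩, -⟩
      refine ContinuousAt.continuousWithinAt ?_
      have h1 := (eventually_chartSheet_eq hQ hij hi hj).prod_inl_nhds f
      have h2 := (eventually_chartSheet_eq hQ (Ne.symm hij) hj hi).prod_inl_nhds f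
      have h3 : ContinuousAt
          (fun p : (Qᶜ : Set ℂ) × FreeGroup Q =>
            p.2 * (chartSheet i (b : ℂ))⁻¹ * chartSheet j (b : ℂ)) (b, f) :=
        ((continuous_of_discreteTopology (f := fun g : FreeGroup Q =>
          g * (chartSheet i (b : ℂ))⁻¹ * chartSheet j (b : ℂ))).comp continuous_snd).continuousAt
      refine h3.congr ?_
      filter_upwards [h1, h2] with p hp1 hp2
      rw [hp1, hp2]
  coordChange_comp i j k b _ f := by group

theorem isCoveringMap_wordCore : IsCoveringMap (wordCore hQ).proj :=
  FiberBundle.isCoveringMap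

/-- The point over `b` on the sheet that is reached from the sheet of `g` over the origin without
crossing a ray. -/
def sheetPt (b : (Qᶜ : Set ℂ)) (g : FreeGroup Q) : (wordCore hQ).proj ⁻¹' {b} :=
  ⟨⟨b, (g * chartSheet ((wordCore hQ).indexAt b) b : FreeGroup Q)⟩, rfl⟩

theorem sheetPt_injective (b : (Qᶜ : Set ℂ)) : Function.Injective (sheetPt hQ b) := by
  intro g h hgh
  have h1 := eq_of_heq (Bundle.TotalSpace.mk.inj (congrArg Subtype.val hgh)).2
  exact mul_right_cancel (G := FreeGroup Q) h1

variable {hQ} {a b : (Qᶜ : Set ℂ)}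

theorem localTriv_symm_eq_sheetPt {i : Option Q} (f : FreeGroup Q) :
    ((wordCore hQ).localTriv i).toOpenPartialHomeomorph.symm (b, f) =
      (sheetPt hQ b (f * (chartSheet i b)⁻¹)).1 := rfl

theorem monodromy_of_mem_chart {i : Option Q} {p : Path a b} (hp : ∀ t, p t ∈ chart hQ i)
    (g : FreeGroup Q) :
    (isCoveringMap_wordCore hQ).monodromy (mk p) (sheetPt hQ a g) =
      sheetPt hQ b (g * chartSheet i a * (chartSheet i b)⁻¹) := by
  let f := g * chartSheet i (a : ℂ)
  let e := (wordCore hQ).localTriv i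
  have hcont : Continuous fun t => e.toOpenPartialHomeomorph.symm (p t, f) := by
    refine e.continuousOn_invFun.comp_continuous (by fun_prop) fun t => ?_
    rw [e.target_eq]
    exact ⟨hp t, Set.mem_univ _⟩
  have h0 : e.toOpenPartialHomeomorph.symm (p 0, f) = (sheetPt hQ a g).1 := by
    rw [p.source, localTriv_symm_eq_sheetPt, mul_inv_cancel_right]
  have h1 : e.toOpenPartialHomeomorph.symm (p 1, f) =
      (sheetPt hQ b (f * (chartSheet i b)⁻¹)).1 := by
    rw [p.target, localTriv_symm_eq_sheetPt]
  -- The lift of `p` inside one chart keeps its coordinate `f` constant; only the sheet to which `f`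
  -- corresponds may change.
  let Γ : Path (sheetPt hQ a g).1 (sheetPt hQ b (f * (chartSheet i b)⁻¹)).1 :=
    ⟨⟨_, hcont⟩, h0, h1⟩
  refine (isCoveringMap_wordCore hQ).monodromy_eq_of_map_eq (mk Γ) ?_
  rfl

/-- Of the three pieces of a lasso, the two straight ones keep the sheet and the passage through the
wedge multiplies it by `y`. -/
theorem monodromy_wordClass_of (y : Q) (g : FreeGroup Q) :
    (isCoveringMap_wordCore hQ).monodromy (wordClass hQ (FreeGroup.of y)) (sheetPt hQ _ g) =
      sheetPt hQ _ (g * FreeGroup.of y) := by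
  rw [wordClass_of_eq, IsCoveringMap.monodromy_trans_apply, IsCoveringMap.monodromy_trans_apply,
    monodromy_of_mem_chart (i := none) (starPath_mem hQ _),
    monodromy_of_mem_chart (i := some y) (wedgePath_mem hQ _ _),
    ← Path.Homotopic.Quotient.mk_symm,
    monodromy_of_mem_chart (i := none)
      (p := (starPath hQ (leftPt hQ y) (leftPt_mem_starDomain hQ y)).symm)
      fun t => starPath_mem hQ (leftPt_mem_starDomain hQ y) _]
  simp [chartSheet, sheet, (rightPt_im hQ y).not_ge, (leftPt_im hQ y).le]

theorem monodromy_wordClass (h g : FreeGroup Q) :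
    (isCoveringMap_wordCore hQ).monodromy (wordClass hQ h) (sheetPt hQ _ g) =
      sheetPt hQ _ (g * h) := by
  induction h using FreeGroup.induction_on generalizing g with
  | C1 => rw [wordClass_one, IsCoveringMap.monodromy_refl, mul_one]; rfl
  | of y => exact monodromy_wordClass_of y g
  | inv_of y ih =>
    have h1 := ih (g * (FreeGroup.of y)⁻¹)
    rw [inv_mul_cancel_right] at h1
    rw [← h1, ← IsCoveringMap.monodromy_trans_apply, ← wordClass_mul, mul_inv_cancel,
      wordClass_one, IsCoveringMap.monodromy_refl]
    rfl
  | mul h k ih ik =>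
    rw [wordClass_mul, IsCoveringMap.monodromy_trans_apply, ih, ik, mul_assoc]

-- The monodromy of a loop determines its word, as the sheet reached from the trivial one.
variable (hQ) in
theorem wordClass_injective : Function.Injective (wordClass hQ) := by
  intro g h hgh
  have h1 := monodromy_wordClass (hQ := hQ) g 1
  rw [hgh, monodromy_wordClass] at h1
  simpa using (sheetPt_injective hQ _ h1).symm

end Covering

/-! ### Counting a letter in a word -/

section Count

variable {A : Type*}

open Classical in
/-- The number of occurrences of the letter `x` and of its inverse in the reduced word of `g`. -/
def letterCount (x : A) (g : FreeGroup A) : ℕ := g.toWord.countP fun a => decide (a.1 = x)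

theorem letterCount_one (x : A) : letterCount x 1 = 0 := by
  classical simp [letterCount, FreeGroup.toWord_one]

/-- Reduction of a concatenated word only deletes letters. -/
theorem letterCount_mul_le (x : A) (g h : FreeGroup A) :
    letterCount x (g * h) ≤ letterCount x g + letterCount x h := by
  classical
  rw [letterCount, letterCount, letterCount, ← List.countP_append]
  exact (FreeGroup.toWord_mul_sublist g h).countP_le

theorem letterCount_inv (x : A) (g : FreeGroup A) : letterCount x g⁻¹ = letterCount x g := by
  classical
  simp [letterCount, FreeGroup.toWord_inv, FreeGroup.invRev, List.countP_reverse, List.countP_map,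
    Function.comp_def]

theorem letterCount_of_self (x : A) : letterCount x (FreeGroup.of x) = 1 := by
  classical simp [letterCount, FreeGroup.toWord_of]

theorem letterCount_of_ne {x y : A} (h : y ≠ x) : letterCount x (FreeGroup.of y) = 0 := by
  classical simp [letterCount, FreeGroup.toWord_of, h]

theorem letterCount_eq_zero {x : A} {g : FreeGroup A}
    (hg : g ∈ Subgroup.closure (FreeGroup.of '' {x}ᶜ)) : letterCount x g = 0 := by
  induction hg using Subgroup.closure_induction with
  | mem _ h =>
    obtain ⟨y, hy, rfl⟩ := h
    exact letterCount_of_ne hy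
  | one => exact letterCount_one x
  | mul g h _ _ hg hh =>
    have := letterCount_mul_le x g h
    omega
  | inv g _ hg => rw [letterCount_inv, hg]

theorem l1Norm_toFinsupp_le (l : List ℤ) [DecidablePred fun i => l.getD i 0 ≠ 0] :
    l1Norm l.toFinsupp ≤ (l.map Int.natAbs).sum := by
  have h : ∑ i ∈ Finset.range l.length, (l.getD i 0).natAbs = (l.map Int.natAbs).sum := by
    induction l with
    | nil => simp
    | cons a l ih => simp only [List.length_cons, Finset.sum_range_succ', List.getD_cons_succ, ih,
        List.getD_cons_zero, List.map_cons, List.sum_cons, add_comm]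
  rw [← h, l1Norm, Finsupp.sum_of_support_subset _ (s := Finset.range l.length)]
  · exact le_rfl
  · intro i hi
    simp only [List.toFinsupp_support, Finset.mem_filter] at hi
    exact hi.1
  · simp

theorem natAbs_sum_le_length (l : List (A × Bool)) :
    (l.map fun c : A × Bool => if c.2 then (1 : ℤ) else -1).sum.natAbs ≤ l.length := by
  induction l with
  | nil => simp
  | cons a l ih =>
    simp only [List.map_cons, List.sum_cons, List.length_cons]
    split_ifs <;> omega

-- All letters of a run agree up to sign, so a run of `x` contributes its whole length to the count,
-- while its exponent is a sum of that many signs.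
open Classical in
theorem sum_natAbs_runs_le (x : A) (L : List (List (A × Bool)))
    (hL : ∀ run ∈ L, run.IsChain fun a b => decide (a.1 = b.1) = true) :
    (((((L.filterMap fun run => run.head?.map fun a =>
      (a.1, (run.map fun c => if c.2 then (1 : ℤ) else -1).sum)).filter
        fun s => decide (s.1 = x)).map Prod.snd).map Int.natAbs).sum) ≤
      L.flatten.countP fun a => decide (a.1 = x) := by
  induction L with
  | nil => simp
  | cons run L ih =>
    have ih := ih fun r hr => hL r (List.mem_cons_of_mem _ hr)
    rw [List.flatten_cons, List.countP_append]
    rcases run with _ | ⟨a, l⟩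
    · simpa using ih
    · rw [List.filterMap_cons_some (b := (a.1, ((a :: l).map fun c =>
        if c.2 then (1 : ℤ) else -1).sum)) (by simp), List.filter_cons]
      split_ifs with h
      · have hall : ∀ c ∈ a :: l, decide (c.1 = x) = true := by
          have hchain := hL (a :: l) List.mem_cons_self
          have hp : (a :: l).Pairwise fun a b => a.1 = b.1 := by
            have h1 : (a :: l).IsChain fun a b => a.1 = b.1 := by simpa using hchain
            have : IsTrans (A × Bool) fun a b => a.1 = b.1 := ⟨fun _ _ _ => Eq.trans⟩
            exact List.isChain_iff_pairwise.1 h1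
          intro c hc
          rcases List.mem_cons.1 hc with rfl | hc
          · exact h
          · have h1 := (List.pairwise_cons.1 hp).1 c hc
            rw [← h1]
            exact h
        have h1 := natAbs_sum_le_length (a :: l)
        rw [List.countP_eq_length.2 hall, List.map_cons, List.map_cons, List.sum_cons]
        exact add_le_add h1 ih
      · exact ih.trans (Nat.le_add_left _ _)

theorem l1Norm_exponentSeq_le (x : A) (g : FreeGroup A) :
    l1Norm (exponentSeq x g) ≤ letterCount x g := by
  classical
  refine (l1Norm_toFinsupp_le _).trans ?_
  refine (sum_natAbs_runs_le x _ fun run hrun => List.isChain_of_mem_splitBy hrun).trans ?_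
  rw [List.flatten_splitBy]
  exact le_rfl

end Count

/-! ### The number of occurrences of a letter needed to represent a path class -/

section Cost

variable {Q : Set ℂ} {hQ : IsGeneric Q} {x : Q} {a b c : (Qᶜ : Set ℂ)}

/-- The path class `α` is represented by a word in which the letter `x` occurs at most `n`
times. -/
def CostLE (hQ : IsGeneric Q) (x : Q) (n : ℕ) (α : Path.Homotopic.Quotient a b) : Prop :=
  ∃ g, Represents hQ g α ∧ letterCount x g ≤ n

theorem CostLE.trans {m n : ℕ} {α : Path.Homotopic.Quotient a b}
    {β : Path.Homotopic.Quotient b c} (hα : CostLE hQ x m α) (hβ : CostLE hQ x n β) :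
    CostLE hQ x (m + n) (α.trans β) := by
  obtain ⟨g, hg, hgm⟩ := hα
  obtain ⟨h, hh, hhn⟩ := hβ
  exact ⟨g * h, hg.trans hh, (letterCount_mul_le x g h).trans (add_le_add hgm hhn)⟩

theorem CostLE.symm {n : ℕ} {α : Path.Homotopic.Quotient a b} (hα : CostLE hQ x n α) :
    CostLE hQ x n α.symm := by
  obtain ⟨g, hg, hgn⟩ := hα
  exact ⟨g⁻¹, hg.symm, (letterCount_inv x g).trans_le hgn⟩

theorem CostLE.mono {m n : ℕ} {α : Path.Homotopic.Quotient a b} (hα : CostLE hQ x m α)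
    (h : m ≤ n) : CostLE hQ x n α := by
  obtain ⟨g, hg, hgm⟩ := hα
  exact ⟨g, hg, hgm.trans h⟩

theorem costLE_refl (a : (Qᶜ : Set ℂ)) : CostLE hQ x 0 (Path.Homotopic.Quotient.refl a) :=
  ⟨1, represents_refl a, (letterCount_one x).le⟩

theorem costLE_cast {n : ℕ} {a' b' : (Qᶜ : Set ℂ)} {α : Path.Homotopic.Quotient a b}
    (ha : a' = a) (hb : b' = b) : CostLE hQ x n (α.cast ha hb) ↔ CostLE hQ x n α := by
  simp only [CostLE, represents_cast]

theorem costLE_zero (hQ : IsGeneric Q) (p : Path a b) (hp : ∀ t, (p t : ℂ) ∉ ray x) :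
    CostLE hQ x 0 (mk p) := by
  obtain ⟨g, hg, hgr⟩ := exists_represents hQ (S := {x}ᶜ) p fun t y hy => by
    obtain rfl : y = x := by simpa using hy
    exact hp t
  exact ⟨g, hgr, (letterCount_eq_zero hg).le⟩

theorem costLE_one_of_mem_wedge {p : Path a b} (hp : ∀ t, (p t : ℂ) ∈ wedge hQ x) :
    CostLE hQ x 1 (mk p) := by
  refine ⟨_, represents_of_mem_wedge hp, ?_⟩
  unfold sheet
  split_ifs <;> simp [letterCount_one, letterCount_of_self, letterCount_inv]

end Cost

/-! ### The half-plane beyond the last puncture -/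

/-- The closed half-plane beyond `x`, without `x`. -/
def beyond (x : ℂ) : Set ℂ := {w | 1 ≤ (w / x).re ∧ w ≠ x}

theorem mem_beyond_of_im_ne_zero {x w : ℂ} (h : 1 ≤ (w / x).re) (him : (w / x).im ≠ 0) :
    w ∈ beyond x := by
  refine ⟨h, ?_⟩
  rintro rfl
  by_cases hw : w = 0
  · simp [hw] at him
  · simp [div_self hw] at him

theorem mem_beyond_of_one_lt {x w : ℂ} (h : 1 < (w / x).re) : w ∈ beyond x := by
  refine ⟨h.le, ?_⟩
  rintro rfl
  by_cases hw : w = 0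
  · simp [hw] at h
    linarith
  · simp [div_self hw] at h

/-- A segment from `2 * x` to a point of the closed half-plane stays in the open half-plane until
its far end, so it can meet `x` only there. -/
theorem starConvex_beyond {x : ℂ} (hx : x ≠ 0) : StarConvex ℝ (2 * x) (beyond x) := by
  rintro w ⟨hw, hwx⟩ a b ha hb hab
  have h2 : (2 * x / x).re = 2 := by rw [mul_div_assoc, div_self hx]; simp
  rcases ha.eq_or_lt with rfl | ha
  · obtain rfl : b = 1 := by linarith
    simpa using ⟨hw, hwx⟩
  · refine mem_beyond_of_one_lt ?_
    rw [div_re_comb, h2]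
    nlinarith

section Beyond

variable {Q : Set ℂ} {hQ : IsGeneric Q} {x : Q} (hmax : ∀ y ∈ Q, ‖y‖ ≤ ‖(x : ℂ)‖)
include hmax

/-- The half-plane is tangent at `x` to the disc of radius `‖x‖`, which contains all of `Q`. -/
theorem beyond_subset (hQ : IsGeneric Q) : beyond x ⊆ Qᶜ := by
  rintro w ⟨h1, h2⟩ hw
  have hx0 := hQ.ne_zero x.2
  have hn : ‖w / x‖ ≤ 1 := by
    rw [norm_div]
    exact div_le_one_of_le₀ (hmax w hw) (norm_nonneg _)
  have hre : (w / x).re = 1 := le_antisymm ((Complex.re_le_norm _).trans hn) h1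
  have him : (w / x).im = 0 := by
    have h3 := Complex.sq_norm (w / x)
    rw [Complex.normSq_apply, hre] at h3
    have h4 : ‖w / x‖ ^ 2 ≤ 1 := pow_le_one₀ (norm_nonneg _) hn
    nlinarith [mul_self_nonneg (w / x).im]
  refine h2 ((div_eq_one_iff_eq hx0).1 (Complex.ext ?_ ?_))
  · rw [hre, Complex.one_re]
  · rw [him, Complex.one_im]

/-- A point off the ray can be moved straight to `rightPt` or `leftPt`, whichever is on its own
side, so the ray of `x` is not crossed. -/
theorem exists_path_to_wedge {a : (Qᶜ : Set ℂ)} (ha : (a : ℂ) ∈ beyond x) :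
    ∃ (a' : (Qᶜ : Set ℂ)) (q : Path a a'), (a' : ℂ) ∈ wedge hQ x ∧
      (∀ t, (q t : ℂ) ∈ beyond x) ∧ CostLE hQ x 0 (mk q) := by
  by_cases him : ((a : ℂ) / x).im = 0
  · exact ⟨a, Path.refl a, mem_wedge_of_mem_ray hQ a.2 ⟨ha.1, him⟩, fun _ => ha, costLE_refl a⟩
  -- The sign `κ` treats the two sides of the ray at once.
  have key : ∀ (κ : ℝ) (a' : (Qᶜ : Set ℂ)), (a' : ℂ) ∈ wedge hQ x → 0 < κ * ((a : ℂ) / x).im →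
      0 < κ * ((a' : ℂ) / x).im → ∃ q : Path a a',
      (∀ t, (q t : ℂ) ∈ beyond x) ∧ CostLE hQ x 0 (mk q) := by
    intro κ a' ha' h h'
    have hseg : segment ℝ (a : ℂ) a' ⊆
        {w : ℂ | 1 ≤ (w / x).re ∧ 0 < κ * (w / x).im} := by
      refine Convex.segment_subset ?_ ⟨ha.1, h⟩ ⟨ha'.2.le, h'⟩
      rintro p ⟨hp1, hp2⟩ q ⟨hq1, hq2⟩ α β hα hβ hαβ
      simp only [Set.mem_ofPred_eq, div_re_comb, div_im_comb] at *
      obtain rfl : β = 1 - α := by linarith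
      refine ⟨by nlinarith, ?_⟩
      rcases hα.lt_or_eq with h | rfl
      · nlinarith
      · simpa using hq2
    have hbey : segment ℝ (a : ℂ) a' ⊆ beyond x := fun w hw =>
      mem_beyond_of_im_ne_zero (hseg hw).1 (right_ne_zero_of_mul (hseg hw).2.ne')
    refine ⟨segPath a a' (hbey.trans (beyond_subset hmax hQ)), segPath_mem _ hbey,
      costLE_zero hQ _ fun t ht => ?_⟩
    have := segPath_mem (hbey.trans (beyond_subset hmax hQ)) hseg t
    exact right_ne_zero_of_mul this.2.ne' ht.2
  rcases lt_or_gt_of_ne him with h | h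
  · obtain ⟨q, hq⟩ := key (-1) (rightPt hQ x) (rightPt_mem_wedge hQ x) (by linarith)
      (by have := rightPt_im hQ x; linarith)
    exact ⟨_, q, rightPt_mem_wedge hQ x, hq⟩
  · obtain ⟨q, hq⟩ := key 1 (leftPt hQ x) (leftPt_mem_wedge hQ x) (by linarith)
      (by have := leftPt_im hQ x; linarith)
    exact ⟨_, q, leftPt_mem_wedge hQ x, hq⟩

/-- A path beyond the last puncture crosses its ray essentially at most once. -/
theorem costLE_one_of_mem_beyond {a b : (Qᶜ : Set ℂ)} {p : Path a b}
    (hp : ∀ t, (p t : ℂ) ∈ beyond x) : CostLE hQ x 1 (mk p) := by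
  obtain ⟨a', q, ha', hq, hqc⟩ := exists_path_to_wedge (hQ := hQ) hmax (by simpa using hp 0)
  obtain ⟨b', r, hb', hr, hrc⟩ := exists_path_to_wedge (hQ := hQ) hmax (by simpa using hp 1)
  have h : mk p = (mk q).trans ((mk (wedgePath hQ x a' b' ha' hb')).trans (mk r).symm) := by
    rw [← Path.Homotopic.Quotient.mk_symm, ← Path.Homotopic.Quotient.mk_trans,
      ← Path.Homotopic.Quotient.mk_trans]
    refine homotopic_of_starConvex (starConvex_beyond (hQ.ne_zero x.2)) (beyond_subset hmax hQ) hp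
      (trans_mem (S := Subtype.val ⁻¹' beyond (x : ℂ)) hq
        (trans_mem (S := Subtype.val ⁻¹' beyond (x : ℂ)) (fun t => ?_) fun t => hr _))
    exact mem_beyond_of_one_lt (wedgePath_mem hQ ha' hb' t).2
  rw [h]
  exact (hqc.trans ((costLE_one_of_mem_wedge (wedgePath_mem hQ ha' hb')).trans hrc.symm)).mono
    le_rfl

/-- A path that starts on the near side of the line through `x` and avoids one of the two halves of
that line crosses the ray from `x` essentially at most once. -/
theorem costLE_one_of_avoid {a b : (Qᶜ : Set ℂ)} (p : Path a b) {s : ℝ} (hs : s * s = 1)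
    (hp : ∀ t, ((p t : ℂ) / x).re = 1 → s * ((p t : ℂ) / x).im < 0)
    (ha : ((a : ℂ) / x).re ≤ 1) : CostLE hQ x 1 (mk p) := by
  have hx0 := hQ.ne_zero x.2
  have hpc : Continuous fun t => (p t : ℂ) := continuous_subtype_val.comp p.continuous
  have hre : Continuous fun t => ((p t : ℂ) / x).re := (continuous_div_re _).comp hpc
  have him : Continuous fun t => ((p t : ℂ) / x).im := (continuous_div_im _).comp hpc
  -- Height of the folded path on the line: unchanged on the near side, and on the far side forced
  -- to satisfy `s * u t < 0`. The two formulas agree on the line because the path avoids the half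
  -- where `0 ≤ s * im`.
  let u : I → ℝ := fun t => if ((p t : ℂ) / x).re ≤ 1 then ((p t : ℂ) / x).im
    else s * (min (s * ((p t : ℂ) / x).im) 0 - (((p t : ℂ) / x).re - 1))
  have hu : Continuous u := by
    refine Continuous.if_le him (by fun_prop) hre continuous_const fun t ht => ?_
    rw [min_eq_left (hp t ht).le, ht, sub_self, sub_zero, ← mul_assoc, hs, one_mul]
  let q₀ : I → ℂ := fun t =>
    ((min ((p t : ℂ) / x).re 1 : ℝ) + (u t : ℝ) * Complex.I : ℂ) * (x : ℂ)
  have hq₀ : Continuous q₀ := by fun_prop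
  have hq₀re : ∀ t, (q₀ t / x).re = min ((p t : ℂ) / x).re 1 := fun t => by
    simp only [q₀, mul_div_assoc, div_self hx0, mul_one, Complex.add_re, Complex.re_ofReal_mul,
      Complex.ofReal_re, Complex.I_re, mul_zero, add_zero]
  have hq₀im : ∀ t, (q₀ t / x).im = u t := fun t => by
    simp only [q₀, mul_div_assoc, div_self hx0, mul_one, Complex.add_im, Complex.im_ofReal_mul,
      Complex.ofReal_im, Complex.I_im, mul_one, zero_add]
  have hnear : ∀ t, ((p t : ℂ) / x).re ≤ 1 → q₀ t = p t := by
    intro t ht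
    have : q₀ t / x = (p t : ℂ) / x := Complex.ext (by rw [hq₀re, min_eq_left ht])
      (by rw [hq₀im]; exact if_pos ht)
    exact (div_left_inj' hx0).1 this
  have hfar : ∀ t, 1 < ((p t : ℂ) / x).re → s * u t < 0 := by
    intro t ht
    have : u t = s * (min (s * ((p t : ℂ) / x).im) 0 - (((p t : ℂ) / x).re - 1)) :=
      if_neg (not_le.2 ht)
    rw [this, ← mul_assoc, hs, one_mul]
    have := min_le_right (s * ((p t : ℂ) / x).im) 0
    linarith
  -- Straight-line homotopy to the folded path. It fixes near points and keeps far points beyond the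
  -- line and away from `x`, hence in the complement of `Q`.
  let G : I × I → ℂ := fun r => (1 - (r.1 : ℝ)) • (p r.2 : ℂ) + (r.1 : ℝ) • q₀ r.2
  have hG : Continuous G := by
    have h1 : Continuous fun r : I × I => (p r.2 : ℂ) := hpc.comp continuous_snd
    have h2 : Continuous fun r : I × I => q₀ r.2 := hq₀.comp continuous_snd
    fun_prop
  have hGnear : ∀ r t, ((p t : ℂ) / x).re ≤ 1 → G (r, t) = p t := by
    intro r t ht
    simp only [G, hnear t ht, ← add_smul, sub_add_cancel, one_smul]
  have hGfar : ∀ r t, 1 < ((p t : ℂ) / x).re → G (r, t) ∈ beyond x := by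
    intro r t ht
    rcases r.2.2.eq_or_lt with hr | hr
    · have : G (r, t) = q₀ t := by simp [G, hr]
      rw [this]
      refine mem_beyond_of_im_ne_zero ?_ ?_
      · rw [hq₀re, min_eq_right ht.le]
      · rw [hq₀im]
        exact right_ne_zero_of_mul (hfar t ht).ne
    · refine mem_beyond_of_one_lt ?_
      simp only [G, div_re_comb, hq₀re, min_eq_right ht.le]
      nlinarith
  have hGmem : ∀ r, G r ∈ Qᶜ := by
    rintro ⟨r, t⟩
    rcases le_or_gt ((p t : ℂ) / x).re 1 with h | h
    · rw [hGnear r t h]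
      exact (p t).2
    · exact beyond_subset hmax hQ (hGfar r t h)
  let F : C(I × I, (Qᶜ : Set ℂ)) := ⟨fun r => ⟨G r, hGmem r⟩, hG.subtype_mk hGmem⟩
  have hF0 : ∀ t, F (0, t) = p t := fun t => Subtype.ext (by simp [F, G])
  have hFa : ∀ r, F (r, 0) = a := fun r => Subtype.ext (by
    have h0 : ((p 0 : ℂ) / x).re ≤ 1 := by rwa [p.source]
    exact (hGnear r 0 h0).trans (by rw [p.source]))
  let q : Path a (F (1, 1)) := ⟨⟨fun t => F (1, t), by fun_prop⟩, hFa 1, rfl⟩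
  let r : Path b (F (1, 1)) :=
    ⟨⟨fun s => F (s, 1), by fun_prop⟩, (hF0 1).trans p.target, rfl⟩
  have hh : (mk p).trans (mk r) = mk q :=
    Path.Homotopic.Quotient.eq.2
      (homotopic_of_square F hF0 (fun _ => rfl) hFa fun _ => rfl)
  have hq : CostLE hQ x 0 (mk q) := by
    refine costLE_zero hQ q fun t ht => ?_
    have hval : (q t : ℂ) = q₀ t := by simp [q, F, G]
    rw [hval] at ht
    have h1 : 1 ≤ ((p t : ℂ) / x).re := (ht.1.trans_eq (hq₀re t)).trans (min_le_left _ _)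
    rcases h1.eq_or_lt with h | h
    · have h2 := hp t h.symm
      rw [← hnear t h.ge, ht.2, mul_zero] at h2
      exact lt_irrefl _ h2
    · have h2 := hfar t h
      rw [← hq₀im, ht.2, mul_zero] at h2
      exact lt_irrefl _ h2
  -- The track of the end point is constant if that point is on the near side, and otherwise lies in
  -- `beyond x`.
  have hr : CostLE hQ x 1 (mk r) := by
    rcases le_or_gt ((p 1 : ℂ) / x).re 1 with h | h
    · refine (costLE_zero hQ r fun t ht => ?_).mono zero_le_one
      have hval : (r t : ℂ) = p 1 := hGnear t 1 h
      rw [hval] at ht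
      have h2 := hp 1 (le_antisymm h ht.1)
      rw [ht.2, mul_zero] at h2
      exact lt_irrefl _ h2
    · exact costLE_one_of_mem_beyond hmax fun t => hGfar t 1 h
  have hpq : mk p = (mk q).trans (mk r).symm := by
    rw [← hh, Path.Homotopic.Quotient.trans_assoc, Path.Homotopic.Quotient.trans_symm,
      Path.Homotopic.Quotient.trans_refl]
  rw [hpq]
  exact (hq.trans hr.symm).mono le_rfl

end Beyond

/-! ### Half-turn times -/

section Times

variable {γ : I → ℂ} {d₁ d₂ : Set ℂ}

theorem halfTurnTime_succ_eq_top {n : ℕ} (h : halfTurnTime γ d₁ d₂ n = ⊤) :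
    halfTurnTime γ d₁ d₂ (n + 1) = ⊤ := by
  rw [halfTurnTime, h]
  exact sInf_eq_top.2 fun _ ⟨_, _, h, _⟩ => absurd h not_top_lt

theorem halfTurnTime_eq_top_of_le {m n : ℕ} (hmn : m ≤ n) (h : halfTurnTime γ d₁ d₂ m = ⊤) :
    halfTurnTime γ d₁ d₂ n = ⊤ := by
  induction n, hmn using Nat.le_induction with
  | base => exact h
  | succ n _ ih => exact halfTurnTime_succ_eq_top ih

/-- The infimum is attained because the half-line is closed. It may equal `t` itself, if later
visits accumulate there, hence `t ≤ t'`. -/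
theorem halfTurnTime_succ_cases (hγ : Continuous γ) (hd₁ : IsClosed d₁) (hd₂ : IsClosed d₂)
    {n : ℕ} {t : I} (ht : halfTurnTime γ d₁ d₂ n = ((t : ℝ) : EReal)) :
    (halfTurnTime γ d₁ d₂ (n + 1) = ⊤ ∧ ∀ u, t < u → γ u ∉ if Odd (n + 1) then d₁ else d₂) ∨
      ∃ t' : I, t ≤ t' ∧ halfTurnTime γ d₁ d₂ (n + 1) = ((t' : ℝ) : EReal) ∧
        (γ t' ∈ if Odd (n + 1) then d₁ else d₂) ∧
        ∀ u, t < u → u < t' → γ u ∉ if Odd (n + 1) then d₁ else d₂ := by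
  rw [halfTurnTime, ht]
  have hd : IsClosed (if Odd (n + 1) then d₁ else d₂) := by split_ifs <;> assumption
  generalize (if Odd (n + 1) then d₁ else d₂) = d at *
  by_cases hne : ∃ u, t < u ∧ γ u ∈ d
  · right
    let s : Set ℝ := {r | ∃ u : I, (u : ℝ) = r ∧ t < u ∧ γ u ∈ d}
    have hs : s.Nonempty := by
      obtain ⟨u, hu⟩ := hne
      exact ⟨u, u, rfl, hu⟩
    have hbdd : BddBelow s := ⟨t, by rintro _ ⟨u, rfl, hu, -⟩; exact hu.le⟩
    have htm : (t : ℝ) ≤ sInf s := le_csInf hs (by rintro _ ⟨u, rfl, hu, -⟩; exact hu.le)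
    have hm1 : sInf s ≤ 1 := by
      obtain ⟨_, u, rfl, hu⟩ := hs
      exact (csInf_le hbdd ⟨u, rfl, hu⟩).trans u.2.2
    let m : I := ⟨sInf s, t.2.1.trans htm, hm1⟩
    have hcl : IsClosed {r : ℝ | γ (Set.projIcc 0 1 zero_le_one r) ∈ d} :=
      hd.preimage (hγ.comp continuous_projIcc)
    have hmd : γ m ∈ d := by
      have h1 : sInf s ∈ {r : ℝ | γ (Set.projIcc 0 1 zero_le_one r) ∈ d} := by
        refine closure_minimal ?_ hcl (csInf_mem_closure hs hbdd)
        rintro _ ⟨u, rfl, -, hu⟩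
        simpa using hu
      have h2 : Set.projIcc 0 1 zero_le_one (sInf s) = m := Set.projIcc_of_mem _ m.2
      simpa [h2] using h1
    refine ⟨m, htm, IsGLB.sInf_eq ⟨?_, ?_⟩, hmd, fun u htu hum hud => ?_⟩
    · rintro _ ⟨u, rfl, hu, hud⟩
      exact EReal.coe_le_coe_iff.2 (csInf_le hbdd ⟨u, rfl, EReal.coe_lt_coe_iff.1 hu, hud⟩)
    · intro e he
      by_contra! hlt
      obtain ⟨q, hq1, hq2⟩ := EReal.lt_iff_exists_real_btwn.1 hlt
      obtain ⟨_, ⟨u, rfl, hu, hud⟩, huq⟩ :=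
        exists_lt_of_csInf_lt hs (EReal.coe_lt_coe_iff.1 hq1)
      have h1 := he ⟨u, rfl, EReal.coe_lt_coe_iff.2 hu, hud⟩
      exact absurd (h1.trans_lt (EReal.coe_lt_coe_iff.2 huq)) hq2.not_gt
    · exact absurd (csInf_le hbdd ⟨u, rfl, htu, hud⟩) (not_le.2 hum)
  · left
    push Not at hne
    refine ⟨?_, hne⟩
    refine sInf_eq_top.2 ?_
    rintro _ ⟨u, rfl, hu, hud⟩
    exact absurd hud (hne u (EReal.coe_lt_coe_iff.1 hu))

theorem exists_eq_halfTurnTime (hγ : Continuous γ) (hd₁ : IsClosed d₁) (hd₂ : IsClosed d₂)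
    {n : ℕ} (h : halfTurnTime γ d₁ d₂ n ≠ ⊤) :
    ∃ t : I, halfTurnTime γ d₁ d₂ n = ((t : ℝ) : EReal) := by
  induction n with
  | zero => exact ⟨0, by simp [halfTurnTime]⟩
  | succ n ih =>
    obtain ⟨t, ht⟩ := ih fun h' => h (halfTurnTime_succ_eq_top h')
    rcases halfTurnTime_succ_cases hγ hd₁ hd₂ ht with h1 | ⟨t', -, h1, -⟩
    · exact absurd h1.1 h
    · exact ⟨t', h1⟩

theorem coe_I_injective {s t : I} (h : ((s : ℝ) : EReal) = ((t : ℝ) : EReal)) : s = t :=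
  Subtype.ext (EReal.coe_eq_coe_iff.1 h)

/-- Infinitely many finite times would converge, and at the limit the path would lie in both closed
half-lines. -/
theorem exists_halfTurnTime_eq_top (hγ : Continuous γ) (hd₁ : IsClosed d₁) (hd₂ : IsClosed d₂)
    (hdisj : ∀ t, γ t ∈ d₁ → γ t ∉ d₂) : ∃ n, halfTurnTime γ d₁ d₂ n = ⊤ := by
  by_contra! h
  choose t ht using fun n => exists_eq_halfTurnTime hγ hd₁ hd₂ (h n)
  have hstep : ∀ n, t n ≤ t (n + 1) ∧ γ (t (n + 1)) ∈ if Odd (n + 1) then d₁ else d₂ := by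
    intro n
    rcases halfTurnTime_succ_cases hγ hd₁ hd₂ (ht n) with h1 | ⟨t', hle, h1, h2, -⟩
    · exact absurd h1.1 (h _)
    · obtain rfl : t (n + 1) = t' := coe_I_injective ((ht (n + 1)).symm.trans h1)
      exact ⟨hle, h2⟩
  have hmono : Monotone t := monotone_nat_of_le_succ fun n => (hstep n).1
  obtain ⟨τ, hτ⟩ : ∃ τ, Filter.Tendsto t Filter.atTop (nhds τ) := by
    have hm : Monotone fun n => (t n : ℝ) := fun _ _ hmn => hmono hmn
    have hlim := tendsto_atTop_ciSup hm ⟨1, by rintro _ ⟨n, rfl⟩; exact (t n).2.2⟩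
    have hmem : (⨆ n, (t n : ℝ)) ∈ I :=
      isClosed_Icc.mem_of_tendsto hlim (Filter.Eventually.of_forall fun n => (t n).2)
    exact ⟨⟨_, hmem⟩, tendsto_subtype_rng.2 hlim⟩
  have hγτ := (hγ.tendsto τ).comp hτ
  have h1 : γ τ ∈ d₁ := by
    refine hd₁.mem_of_frequently_of_tendsto ?_ hγτ
    refine Filter.frequently_atTop.2 fun n => ⟨2 * n + 1, by omega, ?_⟩
    have := (hstep (2 * n)).2
    rwa [if_pos ⟨n, rfl⟩] at this
  have h2 : γ τ ∈ d₂ := by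
    refine hd₂.mem_of_frequently_of_tendsto ?_ hγτ
    refine Filter.frequently_atTop.2 fun n => ⟨2 * n + 1 + 1, by omega, ?_⟩
    have := (hstep (2 * n + 1)).2
    rwa [if_neg (by rw [Nat.not_odd_iff_even]; exact ⟨n + 1, by ring⟩)] at this
  exact hdisj τ h1 h2

/-- The number of half-turns is the first index with an infinite half-turn time. -/
theorem exists_halfTurns_eq (hγ : Continuous γ) (hd₁ : IsClosed d₁) (hd₂ : IsClosed d₂)
    (hdisj : ∀ t, γ t ∈ d₁ → γ t ∉ d₂) :
    ∃ n, halfTurns γ d₁ d₂ = n + 1 ∧ halfTurnTime γ d₁ d₂ n ≠ ⊤ ∧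
      halfTurnTime γ d₁ d₂ (n + 1) = ⊤ := by
  classical
  have hex := exists_halfTurnTime_eq_top hγ hd₁ hd₂ hdisj
  obtain ⟨N, hN⟩ : ∃ N, Nat.find hex = N + 1 := by
    refine Nat.exists_eq_succ_of_ne_zero fun h0 => ?_
    have := Nat.find_spec hex
    rw [h0] at this
    simp [halfTurnTime] at this
  have h1 : halfTurnTime γ d₁ d₂ (N + 1) = ⊤ := hN ▸ Nat.find_spec hex
  have h2 : halfTurnTime γ d₁ d₂ N ≠ ⊤ := Nat.find_min hex (by omega)
  refine ⟨N, ?_, h2, h1⟩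
  -- A greatest element is needed: on an unbounded set of naturals `sSup` would take its default
  -- value `0`.
  have hg : IsGreatest {n : ℕ | halfTurnTime γ d₁ d₂ n ≠ ⊤} N := by
    refine ⟨h2, fun n hn => ?_⟩
    by_contra! hlt
    exact hn (halfTurnTime_eq_top_of_le hlt h1)
  rw [halfTurns, hg.csSup_eq]

end Times

/-! ### The two halves of the line through `x` -/

/-- A half of the line through `x` orthogonal to the direction of `x`, on the side given by the
sign of `s`. -/
def perpRay (x : ℂ) (s : ℝ) : Set ℂ := {w | (w / x).re = 1 ∧ 0 ≤ s * (w / x).im}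

theorem isClosed_perpRay (x : ℂ) (s : ℝ) : IsClosed (perpRay x s) :=
  (isClosed_eq (continuous_div_re x) continuous_const).inter
    (isClosed_le continuous_const (continuous_const.mul (continuous_div_im x)))

theorem halfLine_eq_perpRay {x v : ℂ} (hx : x ≠ 0) {κ s : ℝ} (hv : v = κ * Complex.I * x)
    (hκ : 0 < s * κ) : halfLine x v = perpRay x s := by
  ext w
  constructor
  · rintro ⟨r, hr, rfl⟩
    have : (x + r • v) / x = 1 + (r * κ : ℝ) * Complex.I := by
      rw [hv, Complex.real_smul]
      field_simp
      push_cast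
      ring
    simp only [perpRay, Set.mem_ofPred_eq, this, Complex.add_re, Complex.re_ofReal_mul,
      Complex.I_re, Complex.one_re, Complex.add_im, Complex.im_ofReal_mul, Complex.I_im,
      Complex.one_im]
    refine ⟨by simp, ?_⟩
    have := mul_nonneg hr hκ.le
    rwa [mul_left_comm, ← mul_one (r * κ), ← zero_add (r * κ * 1)] at this
  · rintro ⟨h1, h2⟩
    have hκ0 : κ ≠ 0 := right_ne_zero_of_mul hκ.ne'
    refine ⟨(w / x).im / κ, ?_, ?_⟩
    · have : (w / x).im / κ = s * (w / x).im / (s * κ) := by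
        rw [mul_div_mul_left _ _ (left_ne_zero_of_mul hκ.ne')]
      rw [this]
      positivity
    · have hw : w / x = 1 + ((w / x).im : ℂ) * Complex.I :=
        Complex.ext (by simp [h1]) (by simp)
      have h3 : w = (1 + ((w / x).im : ℂ) * Complex.I) * x := by
        rw [← hw, div_mul_cancel₀ _ hx]
      rw [hv, Complex.real_smul]
      conv_lhs => rw [h3]
      have : (κ : ℂ) ≠ 0 := Complex.ofReal_ne_zero.2 hκ0
      push_cast
      field_simp

/-- Orthogonality makes `v` a real multiple of `I * x`; `s` is the sign of that multiple, so both
orders of the half-lines are covered. -/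
theorem exists_perpRay {x v : ℂ} (hx : x ≠ 0) (hv : v ≠ 0) (hxv : inner ℝ x v = 0) :
    ∃ s : ℝ, s * s = 1 ∧ halfLine x v = perpRay x s ∧ halfLine x (-v) = perpRay x (-s) := by
  have hre : (v / x).re = 0 := by
    rw [Complex.inner] at hxv
    have : v / x = (starRingEnd ℂ x * v) * ((Complex.normSq x)⁻¹ : ℝ) := by
      rw [div_eq_mul_inv, Complex.inv_def]
      push_cast
      ring
    have hxv' : (starRingEnd ℂ x * v).re = 0 := by
      first | exact hxv | (rw [mul_comm]; exact hxv)
    rw [this, Complex.re_mul_ofReal, hxv', zero_mul]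
  have hveq : v = ((v / x).im : ℝ) * Complex.I * x := by
    have : v / x = ((v / x).im : ℂ) * Complex.I := Complex.ext (by simp [hre]) (by simp)
    rw [← this, div_mul_cancel₀ _ hx]
  have hκ : (v / x).im ≠ 0 := by
    intro h
    rw [h] at hveq
    exact hv (by simpa using hveq)
  have hneg : -v = ((-(v / x).im : ℝ) : ℂ) * Complex.I * x := by
    conv_lhs => rw [hveq]
    push_cast
    ring
  rcases lt_or_gt_of_ne hκ with h | h
  · exact ⟨-1, by norm_num, halfLine_eq_perpRay hx hveq (by simpa using h),
      halfLine_eq_perpRay hx hneg (by simpa using h)⟩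
  · exact ⟨1, by norm_num, halfLine_eq_perpRay hx hveq (by simpa using h),
      halfLine_eq_perpRay hx hneg (by simpa using h)⟩

theorem eq_of_mem_perpRay {x w : ℂ} (hx : x ≠ 0) {s : ℝ} (hs : s * s = 1)
    (h1 : w ∈ perpRay x s) (h2 : w ∈ perpRay x (-s)) : w = x := by
  have him : (w / x).im = 0 := by
    have h3 : s * (w / x).im = 0 := le_antisymm (neg_nonneg.1 (neg_mul s _ ▸ h2.2)) h1.2
    have : (w / x).im = s * (s * (w / x).im) := by rw [← mul_assoc, hs, one_mul]
    rw [this, h3, mul_zero]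
  exact (div_eq_one_iff_eq hx).1
    (Complex.ext (by rw [h1.1, Complex.one_re]) (by rw [him, Complex.one_im]))

theorem notMem_ray_of_mem_perpRay {x w : ℂ} (hx : x ≠ 0) {s : ℝ} (hw : w ≠ x)
    (h : w ∈ perpRay x s) : w ∉ ray x := fun hr =>
  hw ((div_eq_one_iff_eq hx).1
    (Complex.ext (by rw [h.1, Complex.one_re]) (by rw [hr.2, Complex.one_im])))

/-! ### The cost of a path up to a half-turn time -/

section Main

variable {Q : Set ℂ} {hQ : IsGeneric Q} {x : Q} (hmax : ∀ y ∈ Q, ‖y‖ ≤ ‖(x : ℂ)‖)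
include hmax

theorem costLE_one_subpath {a b : (Qᶜ : Set ℂ)} (p : Path a b) {s : ℝ} (hs : s * s = 1)
    {t t' : I} (htt : t ≤ t') (hp : ∀ u, t ≤ u → u ≤ t' → (p u : ℂ) ∉ perpRay x s)
    (ht : ((p t : ℂ) / x).re ≤ 1) : CostLE hQ x 1 (mk (p.subpath t t')) := by
  refine costLE_one_of_avoid hmax _ hs (fun u h1 => ?_) ht
  have h2 := subpath_mem p (S := Subtype.val ⁻¹' (perpRay (x : ℂ) s)ᶜ) htt hp u
  by_contra! h3
  exact h2 ⟨h1, h3⟩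

/-- Each interval between consecutive times costs at most one letter. The last two conclusions, that
the path is then not beyond the line and is off the next half-line, are what the next step of the
induction needs. -/
theorem costLE_halfTurnTime {b : (Qᶜ : Set ℂ)} (p : Path ⟨0, hQ.zero_notMem⟩ b) {s : ℝ}
    (hs : s * s = 1) {n : ℕ} {t : I}
    (ht : halfTurnTime (fun t => (p t : ℂ)) (perpRay x s) (perpRay x (-s)) n =
      ((t : ℝ) : EReal)) :
    CostLE hQ x n (mk (p.subpath 0 t)) ∧ ((p t : ℂ) / x).re ≤ 1 ∧
      (p t : ℂ) ∉ if Odd (n + 1) then perpRay (x : ℂ) s else perpRay x (-s) := by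
  have hx0 := hQ.ne_zero x.2
  have hpc : Continuous fun t => (p t : ℂ) := continuous_subtype_val.comp p.continuous
  induction n generalizing t with
  | zero =>
    obtain rfl : t = 0 := coe_I_injective (by rw [← ht]; simp [halfTurnTime])
    refine ⟨by simpa using costLE_refl _, by simp, ?_⟩
    rw [if_pos (by decide), p.source]
    rintro ⟨h, -⟩
    simp at h
  | succ n ih =>
    obtain ⟨t₀, ht₀⟩ := exists_eq_halfTurnTime hpc (isClosed_perpRay x s)
      (isClosed_perpRay x (-s)) (n := n) fun h => by
        rw [halfTurnTime_succ_eq_top h] at ht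
        exact EReal.coe_ne_top _ ht.symm
    obtain ⟨hcost, hre, hnot⟩ := ih ht₀
    rcases halfTurnTime_succ_cases hpc (isClosed_perpRay x s) (isClosed_perpRay x (-s)) ht₀
      with h | ⟨t', hle, h1, hmem, havoid⟩
    · rw [h.1] at ht
      exact absurd ht.symm (EReal.coe_ne_top _)
    obtain rfl : t = t' := coe_I_injective (ht.symm.trans h1)
    have hne : (p t : ℂ) ≠ x := fun h => (p t).2 (h ▸ x.2)
    -- The times cannot coincide, since at `t₀` the path is off the half-line it has to reach.
    have hlt : t₀ < t := lt_of_le_of_ne hle fun h => hnot (h ▸ hmem)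
    obtain ⟨s', hs', hd⟩ : ∃ s', s' * s' = 1 ∧
        (if Odd (n + 1) then perpRay (x : ℂ) s else perpRay x (-s)) = perpRay x s' := by
      split_ifs
      · exact ⟨s, hs, rfl⟩
      · exact ⟨-s, by rw [neg_mul_neg, hs], rfl⟩
    have hray : (p t : ℂ) ∉ ray x := notMem_ray_of_mem_perpRay hx0 hne (hd ▸ hmem)
    -- At `t` the path lies on the half-line to be avoided, so the avoidance bound is applied only
    -- up to an earlier `m`. This `m` is so close to `t` that the path misses the ray of `x` on `[m,
    -- t]`, which then costs nothing.
    obtain ⟨l, hl, hsub⟩ := exists_Ioc_subset_of_mem_nhds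
      (((isClosed_ray (x : ℂ)).isOpen_compl.preimage hpc).mem_nhds hray) ⟨t₀, hlt⟩
    obtain ⟨m, hm1, hm2⟩ := exists_between (max_lt hl hlt)
    have hlm : l < m := (le_max_left _ _).trans_lt hm1
    have htm : t₀ < m := (le_max_right _ _).trans_lt hm1
    refine ⟨?_, ?_, ?_⟩
    · have hc1 : CostLE hQ x 1 (mk (p.subpath t₀ m)) := by
        refine costLE_one_subpath hmax p hs' htm.le (fun u hu1 hu2 => ?_) hre
        rw [← hd]
        rcases hu1.eq_or_lt with rfl | hu1
        · exact hnot
        · exact havoid u hu1 (hu2.trans_lt hm2)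
      have hc2 : CostLE hQ x 0 (mk (p.subpath m t)) :=
        costLE_zero hQ _ (subpath_mem p (S := Subtype.val ⁻¹' (ray (x : ℂ))ᶜ) hm2.le
          fun u hu1 hu2 => hsub ⟨hlm.trans_le hu1, hu2⟩)
      rw [← mk_subpath_trans p 0 m t, ← mk_subpath_trans p 0 t₀ m]
      exact (hcost.trans hc1).trans hc2
    · rw [hd] at hmem
      exact hmem.1.le
    · intro hmem'
      by_cases ho : Odd (n + 1)
      · rw [if_pos ho] at hmem
        rw [if_neg (by simpa [Nat.odd_add_one] using ho)] at hmem'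
        exact hne (eq_of_mem_perpRay hx0 hs hmem hmem')
      · rw [if_neg ho] at hmem
        rw [if_pos (by simpa [Nat.odd_add_one] using ho)] at hmem'
        exact hne (eq_of_mem_perpRay hx0 hs hmem' hmem)

theorem costLE_halfTurns {b : (Qᶜ : Set ℂ)} (p : Path ⟨0, hQ.zero_notMem⟩ b) {s : ℝ}
    (hs : s * s = 1) :
    CostLE hQ x (halfTurns (fun t => (p t : ℂ)) (perpRay x s) (perpRay x (-s))) (mk p) := by
  have hx0 := hQ.ne_zero x.2
  have hpc : Continuous fun t => (p t : ℂ) := continuous_subtype_val.comp p.continuous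
  obtain ⟨n, hn, hn1, hn2⟩ := exists_halfTurns_eq hpc (isClosed_perpRay x s)
    (isClosed_perpRay x (-s)) fun t h1 h2 =>
      (p t).2 (eq_of_mem_perpRay hx0 hs h1 h2 ▸ x.2)
  obtain ⟨t, ht⟩ := exists_eq_halfTurnTime hpc (isClosed_perpRay x s)
    (isClosed_perpRay x (-s)) hn1
  obtain ⟨hcost, hre, hnot⟩ := costLE_halfTurnTime hmax p hs ht
  have havoid : ∀ u, t < u →
      (p u : ℂ) ∉ if Odd (n + 1) then perpRay (x : ℂ) s else perpRay x (-s) := by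
    rcases halfTurnTime_succ_cases hpc (isClosed_perpRay x s) (isClosed_perpRay x (-s)) ht
      with h | ⟨t', -, h, -⟩
    · exact h.2
    · rw [hn2] at h
      exact absurd h.symm (EReal.coe_ne_top _)
  -- After the last finite time the path never meets the next half-line: this is the extra one in
  -- the number of half-turns.
  have hc1 : CostLE hQ x 1 (mk (p.subpath t 1)) := by
    obtain ⟨s', hs', hd⟩ : ∃ s', s' * s' = 1 ∧
        (if Odd (n + 1) then perpRay (x : ℂ) s else perpRay x (-s)) = perpRay x s' := by
      split_ifs
      · exact ⟨s, hs, rfl⟩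
      · exact ⟨-s, by rw [neg_mul_neg, hs], rfl⟩
    refine costLE_one_subpath hmax p hs' t.2.2 (fun u hu1 _ => ?_) hre
    rw [← hd]
    rcases hu1.eq_or_lt with rfl | hu1
    · exact hnot
    · exact havoid u hu1
  have h := hcost.trans hc1
  rw [mk_subpath_trans, Path.subpath_zero_one, Path.Homotopic.Quotient.mk_cast,
    costLE_cast] at h
  rwa [hn]

end Main

/-! ### The closing segment and the main theorem -/

theorem segment_notMem_ray {x z : ℂ} (hx : x ≠ 0) (hz : x ∉ segment ℝ 0 z) (t : I) :
    Path.segment z 0 t ∉ ray x := by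
  rintro ⟨h1, h2⟩
  set w := Path.segment z 0 t with hw
  have hwz : w = (1 - (t : ℝ)) • z := by
    rw [hw]
    simp [AffineMap.lineMap_apply]
    ring
  have hwx : w = (w / x).re • x := by
    have : w / x = ((w / x).re : ℂ) := Complex.ext (by simp) (by simpa using h2)
    rw [Complex.real_smul, ← this, div_mul_cancel₀ _ hx]
  have hpos : 0 < (w / x).re := one_pos.trans_le h1
  -- If `w = (1 - t) • z` equals `c • x` with `1 ≤ c`, then `x = ((1 - t) / c) • z` lies between `0`
  -- and `z`.
  refine hz ⟨1 - (1 - (t : ℝ)) / (w / x).re, (1 - (t : ℝ)) / (w / x).re, ?_, ?_, by ring, ?_⟩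
  · have : (1 - (t : ℝ)) / (w / x).re ≤ 1 := by
      rw [div_le_one hpos]
      exact (sub_le_self _ t.2.1).trans h1
    exact sub_nonneg.2 this
  · exact div_nonneg (sub_nonneg.2 t.2.2) hpos.le
  · rw [smul_zero, zero_add, div_eq_inv_mul, mul_smul, ← hwz]
    conv_lhs => rw [hwx]
    rw [smul_smul]
    have h3 : (((w / x).re • x) / x).re = (w / x).re := by rw [← hwx]
    rw [h3, inv_mul_cancel₀ hpos.ne', one_smul]

end HalfTurns

end

open HalfTurns in
theorem mainTheorem7 (P : Set ℂ) (hP : IsGeneric P)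
    (z : ℂ) (γ : Path (0 : ℂ) z) (hγ : ∀ t, γ t ∉ P)
    (x : ℂ) (hx : x ∈ P)
    (hz : ∀ y ∈ lowerPoints P x, y ∉ segment ℝ 0 z)
    (v : ℂ) (hv : v ≠ 0) (hxv : inner ℝ x v = 0) :
    ∃ g : FreeGroup (lowerPoints P x),
      (∀ h : FreeGroup (lowerPoints P x),
        straightHom (hP.lowerPoints x) h =
            loopClass (closeUp γ) (closeUp_notMem (fun t ht => hγ t ht.1) hz) ↔ h = g) ∧
      l1Norm (exponentSeq ⟨x, hx, le_rfl⟩ g) ≤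
        halfTurns γ (halfLine x v) (halfLine x (-v)) := by
  have hQ := hP.lowerPoints x
  let X : lowerPoints P x := ⟨x, hx, le_rfl⟩
  have hx0 : x ≠ 0 := hP.ne_zero hx
  have hmax : ∀ y ∈ lowerPoints P x, ‖y‖ ≤ ‖(X : ℂ)‖ := fun y hy => hy.2
  have hγQ : ∀ t, γ t ∈ (lowerPoints P x)ᶜ := fun t ht => hγ t ht.1
  have hseg : ∀ t, Path.segment z 0 t ∈ (lowerPoints P x)ᶜ := fun t ht =>
    hz _ ht (by
      rw [segment_symm]
      exact Path.range_segment z 0 ▸ ⟨t, rfl⟩)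
  obtain ⟨s, hs, h1, h2⟩ := exists_perpRay hx0 hv hxv
  -- The closing segment adds nothing: it could meet the ray of `x` only if `x` were on the segment
  -- from `0` to `z`.
  have hcost : CostLE hQ X (halfTurns γ (halfLine x v) (halfLine x (-v)) + 0)
      ((Path.Homotopic.Quotient.mk (restrictPath γ hγQ)).trans
        (Path.Homotopic.Quotient.mk (restrictPath (Path.segment z 0) hseg))) := by
    refine CostLE.trans ?_ (costLE_zero hQ _ fun t =>
      segment_notMem_ray hx0 (hz x ⟨hx, le_rfl⟩) t)
    rw [h1, h2]
    exact costLE_halfTurns hmax (restrictPath γ hγQ) hs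
  obtain ⟨g, hg, hgn⟩ := hcost
  have hclass : loopClass (closeUp γ) (closeUp_notMem (fun t ht => hγ t ht.1) hz) =
      straightHom hQ g := by
    refine MulOpposite.unop_injective (Eq.trans ?_ hg.eq_wordClass)
    refine congrArg Path.Homotopic.Quotient.mk ?_
    ext t
    simp only [closeUp, restrictPath, Path.trans_apply, Path.coe_mk', ContinuousMap.coe_mk]
    split_ifs <;> rfl
  refine ⟨g, fun h => ?_, (l1Norm_exponentSeq_le X g).trans hgn⟩
  rw [hclass]
  exact ⟨fun heq => wordClass_injective hQ (congrArg MulOpposite.unop heq), fun heq => heq ▸ rfl⟩
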